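/- Let $j\ge 3$ and $p\ge 1$, put $m=j+p$, and let $\tau = 1\,2\,\cdots\,(j-1)\,\gamma\,j\in S_m$ (one-line notation), where $\gamma$ is a permutation of the numbers $j+1,\dots,j+p$. Let $\mathrm{des}(w)$ be the number of positions $i$ with $w_i>w_{i+1}$ in a word $w$. Write every cycle of a permutation $\sigma\in S_n$ (fixed points included) as $(c_0,c_1,\dots,c_{\ell-1})$ with $\sigma(c_i)=c_{i+1}$ and $c_0$ its smallest element. Let $\mathrm{cyc}(\sigma)$ be the number of cycles of $\sigma$, and let $\mathrm{cdes}(\sigma)$ be the sum over all cycles of $1+\mathrm{des}(c_0c_1\cdots c_{\ell-1})$. Say that $\sigma$ has a cycle $\tau$-match if some cycle has length $\ell\ge m$ and, for some $r$, the word $c_rc_{r+1}\cdots c_{r+m-1}$ (indices modulo $\ell$) is order-isomorphic to $\tau$. Let $\mathcal{NCMS}_n(\tau)$ be the set of $\sigma\in S_n$ with no cycle $\tau$-match, and $$NCM_\tau(t,x,y)=1+\sum_{n\ge1}\frac{t^n}{n!}\sum_{\sigma\in\mathcal{NCMS}_n(\tau)}x^{\mathrm{cyc}(\sigma)}y^{\mathrm{cdes}(\sigma)}\in\mathbb{Q}[x,y][[t]].$$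 Then there are polynomials $U_{n,\tau}(y)\in\mathbb{Q}[y]$ $(n\ge0)$ with $U_{0,\tau}(y)=1$ such that the formal power series $U_\tau(t,y)=\sum_{n\ge0}U_{n,\tau}(y)\frac{t^n}{n!}$ satisfies $$NCM_\tau(t,x,y)=U_\tau(t,y)^{-x}$$ (where $U^{-x}=\exp(-x\log U)$ as a formal power series in $t$), such that for all $n\ge0$ $$U_{n+j,\tau}(y)=(1-y)\,U_{n+j-1,\tau}(y)-y^{\mathrm{des}(\tau)}\binom np\,U_{n-p+1,\tau}(y),$$ where the last term is $0$ for $n<p$, and such that, with derivatives taken in $t$, $$U_\tau^{(j)}=(1-y)\,U_\tau^{(j-1)}-\frac{t^p}{p!}\,y^{\mathrm{des}(\tau)}\,U_\tau'.$$ -/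

import Mathlib

namespace CycleMatch

/-- The reduction of a word `w` of distinct letters: the `s`-th letter is replaced by its rank among
the letters of `w`. Ranks start at `0`, in agreement with the one-line notation of a permutation of
`Fin m`. -/
def red {n m : ℕ} (w : Fin m → Fin n) (s : Fin m) : ℕ :=
  (Finset.univ.filter fun t : Fin m => w t < w s).card

/-- The number of descents of the word `w 0, w 1, …, w (p - 1)`. -/
def des {n : ℕ} (p : ℕ) (w : ℕ → Fin n) : ℕ :=
  ((Finset.range (p - 1)).filter fun i => w (i + 1) < w i).card

/-- The number of descents of the permutation `τ`, read in one-line notation. -/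
def permDes {m : ℕ} (τ : Equiv.Perm (Fin m)) : ℕ :=
  (Finset.univ.filter fun i : Fin m => ∃ k : Fin m, (k : ℕ) = i + 1 ∧ τ k < τ i).card

open Classical in
/-- The smallest elements of the cycles of `σ` (fixed points are cycles of length one). They index
the cycles of `σ`. -/
noncomputable def cycleMins {n : ℕ} (σ : Equiv.Perm (Fin n)) : Finset (Fin n) :=
  Finset.univ.filter fun a => ∀ b, σ.SameCycle a b → a ≤ b

/-- The length of the cycle of `σ` that contains `a`. -/
noncomputable def cycleLen {n : ℕ} (σ : Equiv.Perm (Fin n)) (a : Fin n) : ℕ :=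
  Function.minimalPeriod σ a

/-- The entry `c_k` of the cycle `(c_0, c_1, …)` of `σ` written with `c_0 = a` first. It is defined
for every natural number `k`, and depends only on `k` modulo the length of the cycle. -/
def cycleEntry {n : ℕ} (σ : Equiv.Perm (Fin n)) (a : Fin n) (k : ℕ) : Fin n :=
  (σ ^ k) a

/-- The number of cycles of `σ`. -/
noncomputable def cyc {n : ℕ} (σ : Equiv.Perm (Fin n)) : ℕ :=
  (cycleMins σ).card

/-- The number of cyclic descents of `σ`: the sum of `1 + des (c_0 … c_{p-1})` over the cycles
`(c_0, …, c_{p-1})` of `σ`, each written with its smallest element first. -/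
noncomputable def cdes {n : ℕ} (σ : Equiv.Perm (Fin n)) : ℕ :=
  ∑ a ∈ cycleMins σ, (1 + des (cycleLen σ a) (cycleEntry σ a))

/-- `σ` has a cycle `τ`-match: some cycle `(c_0, …, c_{p-1})` of `σ` has length `p ≥ m` and, for
some `r`, the word `c_r c_{r+1} … c_{r+m-1}` (indices modulo `p`) reduces to `τ`. -/
def HasCycleMatch {m n : ℕ} (τ : Equiv.Perm (Fin m)) (σ : Equiv.Perm (Fin n)) : Prop :=
  ∃ a ∈ cycleMins σ, m ≤ cycleLen σ a ∧
    ∃ r < cycleLen σ a, ∀ s : Fin m, red (fun t : Fin m => cycleEntry σ a (r + t)) s = (τ s : ℕ)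

open Classical in
/-- The permutations of `n` letters without cycle `τ`-matches. -/
noncomputable def ncms {m : ℕ} (n : ℕ) (τ : Equiv.Perm (Fin m)) : Finset (Equiv.Perm (Fin n)) :=
  Finset.univ.filter fun σ => ¬ HasCycleMatch τ σ

/-- The exponential generating function `∑ a_n t^n / n!`. -/
noncomputable def egf {R : Type*} [CommRing R] [Algebra ℚ R] (a : ℕ → R) : PowerSeries R :=
  PowerSeries.mk fun n => (1 / (n.factorial : ℚ)) • a n

/-- The polynomial `∑ x^{cyc σ} y^{cdes σ}` over the permutations `σ` of `n` letters without cycle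
`τ`-matches, in the ring `ℚ[y][x]`; for `n = 0` it is `1`. -/
noncomputable def ncmPoly {m : ℕ} (τ : Equiv.Perm (Fin m)) (n : ℕ) :
    Polynomial (Polynomial ℚ) :=
  ∑ σ ∈ ncms n τ,
    Polynomial.X ^ cyc σ * Polynomial.C ((Polynomial.X : Polynomial ℚ) ^ cdes σ)

/-- The series `NCM_τ(t, x, y)`, a power series in `t` over `ℚ[y][x]`. -/
noncomputable def NCM {m : ℕ} (τ : Equiv.Perm (Fin m)) :
    PowerSeries (Polynomial (Polynomial ℚ)) :=
  egf (ncmPoly τ)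

/-- The power `f ^ r = exp (r log f)` of a power series `f` with constant term `1`; the exponent
`r` is any element of the coefficient ring. -/
noncomputable def pow {R : Type*} [CommRing R] [Algebra ℚ R] (f : PowerSeries R) (r : R) :
    PowerSeries R :=
  (PowerSeries.exp R).subst (PowerSeries.C r * PowerSeries.logOf f)

end CycleMatch

/-! Write each cycle with its smallest letter first. A match begins with its own smallest letter, so
it cannot wrap past the start of the cycle: cyclic matches are exactly the matching factors of these
words. The weight is thus a product over cycles, and the exponential formula gives `NCM' = x B_1
NCM`, where `B_1` is the generating function of match-free words starting with their minimum,
weighted by `y^(1 + des)` and counted by the letters after the first. Hence `U` is the solution of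
`U' = -B_1 U`, `U(0) = 1`.

To find an equation free of `B_1`, let `B_k` count words that start with their `k` smallest letters
in increasing order. Split such a word as `P u z v` at the smallest letter `z` after the prefix `P`.
If `u` is empty, the prefix has grown to `k + 1` letters. Otherwise `u` descends to `z`, the weight
factors over `P u` and `z v`, and a match can cross the cut only if `k = j - 1` and `u` is a copy of
`γ`. In a prefix of length `j` the first letter is idle and can be dropped, so the system closes:
`B_k' = B_{k+1} + (B_k - y) B_1` for `1 ≤ k < j - 1`, and `B_{j-1}' = B_{j-1} + (B_{j-1} - y -
y^(des τ) t^p / p!) B_1`.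

Multiplication by `U` makes this linear (`iterate_derivative_of_system`). The combinatorial core is
`avoids_append_cons_iff` and `wordSum_insert`; `permSum_eq_linSol` is the exponential formula. -/

namespace CycleMatch

open PowerSeries

/-! ### Linear recursions and the elimination of the auxiliary series -/

section LinSol

variable {R : Type*} [CommRing R]

/-- The sequence whose exponential generating function `Y` solves `Y' = (egf c) Y`, `Y(0) = 1`. -/
noncomputable def linSol (c : ℕ → R) : ℕ → R
  | 0 => 1
  | n + 1 => ∑ i : Fin (n + 1), (n.choose i : R) * (c i * linSol c (n - i))
termination_by n => n
decreasing_by omega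

theorem linSol_zero (c : ℕ → R) : linSol c 0 = 1 := by rw [linSol]

theorem linSol_succ (c : ℕ → R) (n : ℕ) :
    linSol c (n + 1) =
      ∑ i ∈ Finset.range (n + 1), (n.choose i : R) * (c i * linSol c (n - i)) := by
  rw [linSol, ← Fin.sum_univ_eq_sum_range fun i => (n.choose i : R) * (c i * linSol c (n - i))]

theorem derivative_sum_iterate_derivative (U : PowerSeries R) {k : ℕ} (hk : 1 ≤ k) :
    derivative R (∑ i ∈ Finset.Ico 1 k, (derivative R)^[i] U) + derivative R U =
      ∑ i ∈ Finset.Ico 1 (k + 1), (derivative R)^[i] U := by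
  induction k, hk using Nat.le_induction with
  | base => simp
  | succ k hk ih =>
    rw [Finset.sum_Ico_succ_top (by omega), map_add, Finset.sum_Ico_succ_top (by omega), ← ih,
      Function.iterate_succ_apply']
    ring

theorem map_linSol {S : Type*} [CommRing S] (f : R →+* S) (c : ℕ → R) (n : ℕ) :
    f (linSol c n) = linSol (fun n => f (c n)) n := by
  induction n using Nat.strong_induction_on with
  | _ n ih =>
    cases n with
    | zero => rw [linSol_zero, linSol_zero, map_one]
    | succ n =>
      rw [linSol_succ, linSol_succ, map_sum]
      refine Finset.sum_congr rfl fun i _ => ?_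
      rw [map_mul, map_mul, map_natCast, ih (n - i) (by omega)]

/-- The elimination that turns the first order system for the `B k` into an equation of order `j`
for the series `U` with `U' = - B 1 * U`. -/
theorem iterate_derivative_of_system {j : ℕ} (hj : 3 ≤ j) (U c : PowerSeries R) (y : R)
    (B : ℕ → PowerSeries R) (hU : derivative R U = -(B 1 * U))
    (hB : ∀ k, 1 ≤ k → k < j - 1 → derivative R (B k) = B (k + 1) + (B k - C y) * B 1)
    (hB' : derivative R (B (j - 1)) = B (j - 1) + (B (j - 1) - C y - c) * B 1) :
    (derivative R)^[j] U =
      C (1 - y) * (derivative R)^[j - 1] U - c * derivative R U := by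
  -- In `(B k * U)'` the quadratic term `B k * B 1 * U` cancels against `B k * U'`, and `-y * B 1 *
  -- U` is `y * U'`; so each `B k * U` is linear in derivatives of `U`.
  have key : ∀ k, 1 ≤ k → k ≤ j - 1 →
      B k * U = -(derivative R)^[k] U - C y * ∑ i ∈ Finset.Ico 1 k, (derivative R)^[i] U := by
    intro k hk
    induction k, hk using Nat.le_induction with
    | base => intro _; simp [hU]
    | succ k hk ih =>
      intro hkj
      have h1 := congrArg (derivative R) (ih (by omega))
      have h2 := derivative_sum_iterate_derivative U hk
      rw [← h2, Function.iterate_succ_apply']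
      simp only [Derivation.leibniz, map_sub, map_neg, smul_eq_mul, derivative_C] at h1
      rw [hB k hk (by omega), hU] at h1
      rw [hU]
      linear_combination h1
  obtain ⟨k, rfl⟩ : ∃ k, j = k + 2 := ⟨j - 2, by omega⟩
  have h1 := congrArg (derivative R) (key (k + 1) (by omega) (by omega))
  have h3 := key (k + 1) (by omega) (by omega)
  simp only [show k + 2 - 1 = k + 1 by omega] at *
  -- Differentiating the top identity once more, the two sums telescope and leave only `y` times the
  -- derivative of order `j - 1`.
  have h2 := derivative_sum_iterate_derivative U (Nat.succ_pos k)
  rw [Finset.sum_Ico_succ_top (Nat.succ_pos k)] at h2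
  rw [Function.iterate_succ_apply' (n := k + 1)]
  simp only [Derivation.leibniz, map_sub, map_neg, smul_eq_mul, derivative_C] at h1
  rw [hB', hU] at h1
  rw [hU] at h2 ⊢
  rw [map_sub, map_one]
  linear_combination h1 - h3 - C y * h2

end LinSol

/-! ### Exponential generating functions and powers of series -/

section Egf

variable {R : Type*} [CommRing R] [Algebra ℚ R]

theorem coeff_egf (a : ℕ → R) (n : ℕ) :
    coeff n (egf a) = (1 / (n.factorial : ℚ)) • a n := by
  simp [egf]

theorem constantCoeff_egf (a : ℕ → R) : constantCoeff (egf a) = a 0 := by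
  rw [← coeff_zero_eq_constantCoeff_apply, coeff_egf]; simp

theorem egf_injective : Function.Injective (egf : (ℕ → R) → PowerSeries R) := by
  intro a b h
  funext n
  have h1 := congrArg (coeff n) h
  rw [coeff_egf, coeff_egf] at h1
  have h2 := congrArg (fun r => (n.factorial : ℚ) • r) h1
  have h3 : (n.factorial : ℚ) ≠ 0 := by exact_mod_cast n.factorial_ne_zero
  simpa [smul_smul, h3] using h2

theorem egf_add (a b : ℕ → R) : egf a + egf b = egf fun n => a n + b n := by
  ext n; simp [coeff_egf]

theorem egf_sub (a b : ℕ → R) : egf a - egf b = egf fun n => a n - b n := by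
  ext n; simp [coeff_egf, smul_sub]

theorem egf_mul (a b : ℕ → R) :
    egf a * egf b =
      egf fun n => ∑ i ∈ Finset.range (n + 1), (n.choose i : R) * (a i * b (n - i)) := by
  ext n
  rw [coeff_mul, coeff_egf, Finset.Nat.sum_antidiagonal_eq_sum_range_succ_mk, Finset.smul_sum]
  refine Finset.sum_congr rfl fun i hi => ?_
  have hi' : i ≤ n := Nat.lt_succ_iff.mp (Finset.mem_range.mp hi)
  rw [coeff_egf, coeff_egf, smul_mul_smul_comm, ← map_natCast (algebraMap ℚ R),
    ← Algebra.smul_def, smul_smul]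
  congr 1
  rw [Nat.cast_choose ℚ hi']
  have h1 : (i.factorial : ℚ) ≠ 0 := by exact_mod_cast i.factorial_ne_zero
  have h2 : ((n - i).factorial : ℚ) ≠ 0 := by exact_mod_cast (n - i).factorial_ne_zero
  have h3 : (n.factorial : ℚ) ≠ 0 := by exact_mod_cast n.factorial_ne_zero
  field_simp

theorem C_mul_egf (r : R) (a : ℕ → R) : C r * egf a = egf fun n => r * a n := by
  ext n; simp [coeff_egf]

theorem derivative_egf (a : ℕ → R) : derivative R (egf a) = egf fun n => a (n + 1) := by
  ext n
  have h : ((n : R) + 1) = algebraMap ℚ R ((n : ℚ) + 1) := by simp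
  rw [coeff_derivative, coeff_egf, coeff_egf, h, mul_comm, ← Algebra.smul_def, smul_smul]
  congr 1
  rw [Nat.factorial_succ]
  have h3 : (n.factorial : ℚ) ≠ 0 := by exact_mod_cast n.factorial_ne_zero
  have h4 : (n : ℚ) + 1 ≠ 0 := by positivity
  push_cast
  field_simp

theorem iterate_derivative_egf (a : ℕ → R) (k : ℕ) :
    (derivative R)^[k] (egf a) = egf fun n => a (n + k) := by
  induction k generalizing a with
  | zero => rfl
  | succ k ih =>
    rw [Function.iterate_succ_apply, derivative_egf, ih]
    rfl

theorem egf_single (p : ℕ) (r : R) :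
    egf (fun n => if n = p then r else 0) = C ((1 / (p.factorial : ℚ)) • r) * X ^ p := by
  ext n
  rw [coeff_egf, coeff_C_mul_X_pow]
  split_ifs with h
  · rw [h]
  · simp

theorem map_egf {S : Type*} [CommRing S] [Algebra ℚ S] (f : R →+* S) (a : ℕ → R) :
    map f (egf a) = egf fun n => f (a n) := by
  ext n
  simp only [coeff_map, coeff_egf, Algebra.smul_def, map_mul]
  congr 1
  exact RingHom.congr_fun (Subsingleton.elim (f.comp (algebraMap ℚ R)) (algebraMap ℚ S)) _

theorem derivative_egf_linSol (c : ℕ → R) :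
    derivative R (egf (linSol c)) = egf c * egf (linSol c) := by
  rw [derivative_egf, egf_mul]
  congr 1
  funext n
  exact linSol_succ c n

theorem exists_eq_egf (f : PowerSeries R) : ∃ a : ℕ → R, f = egf a := by
  refine ⟨fun n => (n.factorial : ℚ) • coeff n f, ?_⟩
  ext n
  have h3 : (n.factorial : ℚ) ≠ 0 := by exact_mod_cast n.factorial_ne_zero
  rw [coeff_egf, smul_smul, one_div_mul_cancel h3, one_smul]

/-- Uniqueness for the equation `Y' = (egf c) Y`, `Y(0) = 1`. -/
theorem eq_egf_linSol {c : ℕ → R} {Y : PowerSeries R} (h0 : constantCoeff Y = 1)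
    (h : derivative R Y = egf c * Y) : Y = egf (linSol c) := by
  obtain ⟨a, rfl⟩ := exists_eq_egf Y
  rw [constantCoeff_egf] at h0
  rw [derivative_egf, egf_mul] at h
  have h' := congrFun (egf_injective h)
  congr 1
  funext n
  induction n using Nat.strong_induction_on with
  | _ n ih =>
    cases n with
    | zero => rw [h0, linSol_zero]
    | succ n =>
      rw [h' n, linSol_succ]
      exact Finset.sum_congr rfl fun i _ => by rw [ih (n - i) (by omega)]

/-- Chain rule: the derivative of `log (1 + X)` is the alternating geometric series, the inverse of
`1 + X`; substitute `f - 1`. -/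
theorem mul_derivative_logOf {f : PowerSeries R} (hf : constantCoeff f = 1) :
    f * derivative R (logOf f) = derivative R f := by
  have hs : HasSubst (f - 1) := HasSubst.of_constantCoeff_zero' (by simp [hf])
  rw [logOf_eq, derivative_subst hs, deriv_log]
  set g : PowerSeries R := mk fun n ↦ algebraMap ℚ R ((-1 : ℚ) ^ n) with hg
  have h1 : (1 + X) * g = 1 := by
    ext n
    cases n with
    | zero => simp [hg, add_mul]
    | succ n => simp [hg, add_mul, coeff_succ_X_mul, pow_succ, coeff_one]
  have h2 : (1 + (f - 1)) * g.subst (f - 1) = 1 := by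
    have := congrArg (substAlgHom (R := R) hs) h1
    rw [map_mul, map_add, map_one, coe_substAlgHom, subst_X hs] at this
    exact this
  rw [add_sub_cancel] at h2
  rw [← mul_assoc, h2, one_mul, map_sub, derivative_one, sub_zero]

theorem constantCoeff_pow {f : PowerSeries R} (hf : constantCoeff f = 1) (r : R) :
    constantCoeff (pow f r) = 1 := by
  have h0 : constantCoeff (C r * logOf f) = 0 := by simp [constantCoeff_logOf hf]
  have hs : HasSubst (C r * logOf f) := HasSubst.of_constantCoeff_zero' h0
  have h1 : exp R = 1 + X * mk fun n => coeff (n + 1) (exp R) := by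
    rw [← sub_const_eq_X_mul_shift]
    simp
  rw [pow, h1, ← coe_substAlgHom hs, map_add, map_one, map_mul, coe_substAlgHom, subst_X hs]
  simp [h0]

theorem mul_derivative_pow {f : PowerSeries R} (hf : constantCoeff f = 1) (r : R) :
    f * derivative R (pow f r) = C r * derivative R f * pow f r := by
  have h0 : constantCoeff (C r * logOf f) = 0 := by simp [constantCoeff_logOf hf]
  have hs : HasSubst (C r * logOf f) := HasSubst.of_constantCoeff_zero' h0
  rw [pow, derivative_subst hs, derivative_exp, ← mul_derivative_logOf hf]
  simp only [Derivation.leibniz, derivative_C, smul_eq_mul]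
  ring

/-- Both sides solve `Y' = r (egf c) Y` with `Y(0) = 1`; the base has constant term `1`, so it can
be cancelled from the differential equation of its power. -/
theorem pow_egf_linSol (c : ℕ → R) (r : R) :
    pow (egf (linSol c)) r = egf (linSol fun n => r * c n) := by
  have hf : constantCoeff (egf (linSol c)) = 1 := by rw [constantCoeff_egf, linSol_zero]
  apply eq_egf_linSol (constantCoeff_pow hf r)
  have h := mul_derivative_pow hf r
  rw [derivative_egf_linSol, ← C_mul_egf] at *
  have hu : IsUnit (egf (linSol c)) := isUnit_iff_constantCoeff.mpr (by rw [hf]; exact isUnit_one)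
  apply hu.mul_left_cancel
  rw [h]
  ring

theorem pow_map_egf_linSol_neg {S : Type*} [CommRing S] [Algebra ℚ S] (f : R →+* S) (c : ℕ → R)
    (x : S) :
    pow (map f (egf (linSol fun n => -c n))) (-x) = egf (linSol fun n => x * f (c n)) := by
  rw [map_egf]
  simp only [map_linSol, map_neg]
  rw [pow_egf_linSol]
  simp only [neg_mul_neg]

end Egf

end CycleMatch
namespace CycleMatch

/-! ### Words on a finite set and their descents -/

section Words

variable {α : Type*} [LinearOrder α]

theorem exists_min_insert {S : Finset α} (hS : S.Nonempty) :
    ∃ z S', z ∉ S' ∧ insert z S' = S ∧ ∀ x ∈ S', z < x :=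
  ⟨S.min' hS, S.erase (S.min' hS), Finset.notMem_erase _ _,
    Finset.insert_erase (S.min'_mem hS), fun _ hx => S.min'_lt_of_mem_erase_min' hS hx⟩

/-- The words in which every element of `S` occurs exactly once. -/
def words (S : Finset α) : Finset (List α) :=
  ⟨Multiset.lists S.val, Multiset.lists_nodup_finset S⟩

theorem mem_words {S : Finset α} {l : List α} : l ∈ words S ↔ l.Nodup ∧ l.toFinset = S := by
  rw [words, Finset.mem_mk, Multiset.mem_lists_iff, Multiset.quot_mk_to_coe]
  constructor
  · intro h
    have hn : l.Nodup := by
      rw [← Multiset.coe_nodup, ← h]; exact S.nodup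
    refine ⟨hn, ?_⟩
    ext a
    rw [List.mem_toFinset, ← Finset.mem_val, h, Multiset.mem_coe]
  · rintro ⟨hn, rfl⟩
    rw [List.toFinset_val, hn.dedup]

theorem mem_of_mem_words {S : Finset α} {l : List α} (h : l ∈ words S) {a : α} :
    a ∈ l ↔ a ∈ S := by
  rw [← (mem_words.mp h).2, List.mem_toFinset]

theorem length_of_mem_words {S : Finset α} {l : List α} (h : l ∈ words S) :
    l.length = S.card := by
  rw [← (mem_words.mp h).2, List.toFinset_card_of_nodup (mem_words.mp h).1]

theorem words_empty : words (∅ : Finset α) = {[]} := by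
  ext l
  rw [mem_words, Finset.mem_singleton, List.toFinset_eq_empty_iff]
  constructor
  · exact fun h => h.2
  · rintro rfl; simp

omit [LinearOrder α] in
theorem append_cons_inj_of_notMem {z : α} {u u' v v' : List α} (hu : z ∉ u) (hu' : z ∉ u')
    (h : u ++ z :: v = u' ++ z :: v') : u = u' ∧ v = v' := by
  induction u generalizing u' with
  | nil =>
    cases u' with
    | nil => simpa using h
    | cons a u' => simp at h hu'; exact absurd h.1 hu'.1
  | cons b u ih =>
    cases u' with
    | nil => simp at h hu; exact absurd h.1.symm hu.1
    | cons a u' =>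
      simp only [List.cons_append, List.cons.injEq, List.mem_cons, not_or] at h hu hu'
      obtain ⟨h1, h2⟩ := ih hu.2 hu'.2 h.2
      exact ⟨by rw [h.1, h1], h2⟩

/-- Splitting the words on `insert z S` at the letter `z`. -/
theorem sum_words_insert {M : Type*} [AddCommMonoid M] {S : Finset α} {z : α} (hz : z ∉ S)
    (f : List α → M) :
    ∑ l ∈ words (insert z S), f l =
      ∑ T ∈ S.powerset, ∑ u ∈ words T, ∑ v ∈ words (S \ T), f (u ++ z :: v) := by
  have h : ∀ T ∈ S.powerset, ∑ u ∈ words T, ∑ v ∈ words (S \ T), f (u ++ z :: v) =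
      ∑ q ∈ words T ×ˢ words (S \ T), f (q.1 ++ z :: q.2) := fun T _ => by
    rw [Finset.sum_product]
  rw [Finset.sum_congr rfl h, Finset.sum_sigma']
  symm
  refine Finset.sum_bij (fun q _ => q.2.1 ++ z :: q.2.2) ?_ ?_ ?_ fun _ _ => rfl
  · rintro ⟨T, u, v⟩ hq
    simp only [Finset.mem_sigma, Finset.mem_powerset, Finset.mem_product] at hq
    obtain ⟨hT, hu, hv⟩ := hq
    have hu' := fun a => mem_of_mem_words hu (a := a)
    have hv' := fun a => mem_of_mem_words hv (a := a)
    rw [mem_words] at hu hv ⊢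
    constructor
    · rw [List.nodup_append']
      refine ⟨hu.1, List.nodup_cons.mpr ⟨fun h => ?_, hv.1⟩, ?_⟩
      · exact hz (Finset.mem_sdiff.mp ((hv' z).mp h)).1
      · intro a ha hb
        rcases List.mem_cons.mp hb with rfl | hb
        · exact hz (hT ((hu' a).mp ha))
        · exact (Finset.mem_sdiff.mp ((hv' a).mp hb)).2 ((hu' a).mp ha)
    · ext a
      simp only [List.mem_toFinset, List.mem_append, List.mem_cons, hu', hv', Finset.mem_insert,
        Finset.mem_sdiff]
      have := @hT a
      tauto
  · rintro ⟨T, u, v⟩ hq ⟨T', u', v'⟩ hq' heq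
    simp only [Finset.mem_sigma, Finset.mem_powerset, Finset.mem_product] at hq hq'
    obtain ⟨h1, h2⟩ := append_cons_inj_of_notMem
      (fun h => hz (hq.1 ((mem_of_mem_words hq.2.1).mp h)))
      (fun h => hz (hq'.1 ((mem_of_mem_words hq'.2.1).mp h))) heq
    have h3 : T = T' := by
      rw [← (mem_words.mp hq.2.1).2, ← (mem_words.mp hq'.2.1).2]
      exact congrArg _ h1
    simp only at h1 h2
    subst h1 h2 h3
    rfl
  · intro l hl
    have hm := fun a => mem_of_mem_words hl (a := a)
    obtain ⟨u, v, rfl⟩ := List.append_of_mem ((hm z).mpr (Finset.mem_insert_self z S))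
    have hn := (mem_words.mp hl).1
    rw [List.nodup_append', List.nodup_cons] at hn
    obtain ⟨hn1, ⟨hn2, hn3⟩, hn4⟩ := hn
    have hdis : ∀ a, a ∈ u → a ∉ v ∧ a ≠ z := fun a ha =>
      ⟨fun h => hn4 ha (List.mem_cons_of_mem _ h), fun h => hn4 ha (by rw [h]; simp)⟩
    have hzu : z ∉ u := fun h => (hdis z h).2 rfl
    simp only [List.mem_append, List.mem_cons, Finset.mem_insert] at hm
    refine ⟨⟨u.toFinset, u, v⟩, ?_, rfl⟩
    simp only [Finset.mem_sigma, Finset.mem_powerset, Finset.mem_product, mem_words, and_true,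
      true_and, hn1, hn3]
    constructor
    · intro a ha
      rw [List.mem_toFinset] at ha
      have := (hm a).mp (Or.inl ha)
      exact this.resolve_left (hdis a ha).2
    · ext a
      have h1 := hm a
      have h2 := hdis a
      have h3 : a = z → a ∉ S := fun h => h ▸ hz
      have h4 : a = z → a ∉ v := fun h => h ▸ hn2
      simp only [List.mem_toFinset, Finset.mem_sdiff]
      tauto

/-- The number of descents of a word. -/
def listDes : List α → ℕ
  | a :: b :: l => (if b < a then 1 else 0) + listDes (b :: l)
  | _ => 0

theorem listDes_append_cons (u : List α) (z : α) (v : List α) :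
    listDes (u ++ z :: v) = listDes (u ++ [z]) + listDes (z :: v) := by
  induction u with
  | nil => simp [listDes]
  | cons a u ih =>
    cases u with
    | nil => simp [listDes]
    | cons b u =>
      simp only [List.cons_append] at ih
      simp only [List.cons_append, listDes, ih, add_assoc]

theorem listDes_concat_concat (u : List α) (a z : α) :
    listDes (u ++ [a] ++ [z]) = listDes (u ++ [a]) + if z < a then 1 else 0 := by
  rw [List.append_assoc, List.singleton_append, listDes_append_cons]
  simp [listDes]

theorem listDes_eq_zero {l : List α} (h : l.Pairwise (· < ·)) : listDes l = 0 := by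
  induction l with
  | nil => rfl
  | cons a l ih =>
    cases l with
    | nil => rfl
    | cons b l =>
      rw [List.pairwise_cons] at h
      rw [listDes, ih h.2, if_neg (h.1 b (by simp)).not_gt]

theorem listDes_append {u v : List α} (h : ∀ a ∈ u, ∀ b ∈ v, a < b) :
    listDes (u ++ v) = listDes u + listDes v := by
  induction u with
  | nil => simp [listDes]
  | cons a u ih =>
    have ih := ih fun a ha => h a (List.mem_cons_of_mem _ ha)
    cases u with
    | nil =>
      cases v with
      | nil => simp [listDes]
      | cons b v =>
        simp only [List.cons_append, List.nil_append, listDes]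
        rw [if_neg (h a (by simp) b (by simp)).not_gt]
    | cons b u =>
      simp only [List.cons_append] at ih
      simp only [List.cons_append, listDes, ih, add_assoc]

theorem listDes_map {β : Type*} [LinearOrder β] {e : α → β} (he : StrictMono e) (l : List α) :
    listDes (l.map e) = listDes l := by
  induction l with
  | nil => rfl
  | cons a l ih =>
    cases l with
    | nil => rfl
    | cons b l =>
      simp only [List.map_cons] at ih
      simp only [List.map_cons, listDes, ih, he.lt_iff_lt]

theorem listDes_map_range (w : ℕ → α) (n : ℕ) :
    listDes ((List.range n).map w) =
      ((Finset.range (n - 1)).filter fun i => w (i + 1) < w i).card := by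
  induction n with
  | zero => rfl
  | succ n ih =>
    cases n with
    | zero => rfl
    | succ n =>
      rw [List.range_succ, List.map_append, List.range_succ, List.map_append, List.map_singleton,
        List.map_singleton, listDes_concat_concat, ← List.map_singleton, ← List.map_append,
        ← List.range_succ, ih, Nat.add_sub_cancel, Nat.add_sub_cancel, Finset.range_add_one,
        Finset.filter_insert]
      split_ifs with h
      · rw [Finset.card_insert_of_notMem (by simp)]
      · rfl

end Words

end CycleMatch
namespace CycleMatch

/-! ### Where matches can sit in a word -/

section Matches

variable {α : Type*} [LinearOrder α] {j p : ℕ} {γ : Equiv.Perm (Fin p)}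

/-- The word `G` is order isomorphic to `γ`. -/
def IsGamma (γ : Equiv.Perm (Fin p)) (G : List α) : Prop :=
  ∃ e : Fin p ↪o α, G = List.ofFn fun k => e (γ k)

/-- The word `u` is order isomorphic to `1 2 ⋯ (j - 1) γ j`. -/
def IsMatch (j : ℕ) (γ : Equiv.Perm (Fin p)) (u : List α) : Prop :=
  ∃ (P G : List α) (z : α), u = P ++ (G ++ [z]) ∧ P.length = j - 1 ∧
    (P ++ [z]).Pairwise (· < ·) ∧ (∀ g ∈ G, z < g) ∧ IsGamma γ G

/-- No factor of the word `l` is order isomorphic to `1 2 ⋯ (j - 1) γ j`. -/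
def Avoids (j : ℕ) (γ : Equiv.Perm (Fin p)) (l : List α) : Prop :=
  ∀ u, u <:+: l → ¬ IsMatch j γ u

theorem IsGamma.length {G : List α} (h : IsGamma γ G) : G.length = p := by
  obtain ⟨e, rfl⟩ := h
  simp

theorem IsMatch.length {u : List α} (h : IsMatch j γ u) : u.length = j - 1 + (p + 1) := by
  obtain ⟨P, G, z, rfl, hP, -, -, hG⟩ := h
  simp [hP, hG.length]

theorem Avoids.of_infix {l l' : List α} (h : Avoids j γ l) (h' : l' <:+: l) : Avoids j γ l' :=
  fun u hu => h u (hu.trans h')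

theorem avoids_of_length_lt {l : List α} (h : l.length < j - 1 + (p + 1)) : Avoids j γ l :=
  fun u hu hm => by
    have := hu.length_le
    rw [hm.length] at this
    omega

theorem IsGamma.listDes_eq {G : List α} (h : IsGamma γ G) :
    listDes G = listDes (List.ofFn γ) := by
  obtain ⟨e, rfl⟩ := h
  rw [← listDes_map e.strictMono, List.map_ofFn]
  rfl

/-- Every set with `p` elements has exactly one listing that is order isomorphic to `γ`. -/
theorem sum_words_isGamma {M : Type*} [AddCommMonoid M] (T : Finset α) (c : M)
    [DecidablePred fun u : List α => IsGamma γ u] :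
    ∑ u ∈ words T, (if IsGamma γ u then c else 0) = if T.card = p then c else 0 := by
  split_ifs with hT
  · set u₀ : List α := List.ofFn fun k => T.orderEmbOfFin hT (γ k) with hu₀
    have h0 : IsGamma γ u₀ := ⟨_, rfl⟩
    have hmem : u₀ ∈ words T := by
      rw [mem_words]
      constructor
      · rw [List.nodup_ofFn]
        exact (T.orderEmbOfFin hT).injective.comp γ.injective
      · ext a
        have h1 : a ∈ Set.range (T.orderEmbOfFin hT) ↔ a ∈ T := by
          rw [Finset.range_orderEmbOfFin]; rfl
        rw [List.mem_toFinset, List.mem_ofFn, ← h1]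
        exact ⟨fun ⟨k, hk⟩ => ⟨γ k, hk⟩, fun ⟨k, hk⟩ => ⟨γ.symm k, by simpa using hk⟩⟩
    rw [Finset.sum_eq_single_of_mem u₀ hmem, if_pos h0]
    intro u hu hne
    rw [if_neg]
    rintro ⟨e, rfl⟩
    apply hne
    have h2 : e = T.orderEmbOfFin hT := by
      apply Finset.orderEmbOfFin_unique'
      intro k
      rw [← mem_of_mem_words hu, List.mem_ofFn]
      exact ⟨γ.symm k, by simp⟩
    rw [hu₀, h2]
  · refine Finset.sum_eq_zero fun u hu => if_neg fun h => hT ?_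
    rw [← length_of_mem_words hu, h.length]

-- A factor lies before the marked `z`, or lies in `z :: v`, or straddles the cut; in the last case
-- `d` is the letter just before `z`.
omit [LinearOrder α] in
theorem infix_append_cons {s M t L v : List α} {z : α} (h : s ++ (M ++ t) = L ++ z :: v) :
    M <:+: L ∨ M <:+: z :: v ∨
      ∃ a d c, a ++ [d] <:+ L ∧ c <+: v ∧ M = a ++ [d] ++ z :: c ∧ L = s ++ (a ++ [d]) := by
  rcases List.append_eq_append_iff.mp h with ⟨L', h1, h2⟩ | ⟨w, h1, h2⟩
  · rcases List.append_eq_append_iff.mp h2 with ⟨L'', h3, h4⟩ | ⟨w, h3, h4⟩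
    · left
      exact ⟨s, L'', by rw [h1, h3, List.append_assoc]⟩
    · rcases List.eq_nil_or_concat L' with rfl | ⟨a, d, rfl⟩
      · right; left
        exact ⟨[], t, by simpa using h2⟩
      · cases w with
        | nil =>
          left
          exact ⟨s, [], by rw [h1, h3]; simp⟩
        | cons z' c =>
          right; right
          simp only [List.cons_append, List.cons.injEq] at h4
          refine ⟨a, d, c, ⟨s, by rw [h1]; simp⟩, ⟨t, h4.2.symm⟩, ?_, by rw [h1]; simp⟩
          rw [h3, h4.1]; simp
  · right; left
    exact ⟨w, t, by rw [h2, List.append_assoc]⟩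

/-- How matches sit in a word `P u z v` in which `P` is increasing and `z` is smaller than all
letters of `u` and `v`, but not than those of `P`. -/
theorem avoids_append_cons_iff (hj : 3 ≤ j) (hp : 1 ≤ p) {P u v : List α} {z : α}
    (hPz : (P ++ [z]).Pairwise (· < ·)) (hPj : P.length ≤ j - 1)
    (hu : u ≠ []) (hzu : ∀ x ∈ u, z < x) (hzv : ∀ x ∈ v, z < x) :
    Avoids j γ (P ++ u ++ z :: v) ↔
      Avoids j γ (P ++ u) ∧ Avoids j γ (z :: v) ∧ ¬ (P.length = j - 1 ∧ IsGamma γ u) := by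
  constructor
  · intro h
    refine ⟨h.of_infix ⟨[], z :: v, by simp⟩, h.of_infix ⟨P ++ u, [], by simp⟩, ?_⟩
    rintro ⟨hP, hg⟩
    exact h (P ++ (u ++ [z])) ⟨[], v, by simp⟩ ⟨P, u, z, rfl, hP, hPz, hzu, hg⟩
  · rintro ⟨h1, h2, h3⟩ M ⟨s, t, hst⟩ hM
    rw [List.append_assoc] at hst
    rcases infix_append_cons hst with h | h | ⟨a, d, c, had, hc, hMeq, hL⟩
    · exact h1 M h hM
    · exact h2 M h hM
    -- A straddling match `Q G y` contains the descent from `d` (the last letter of `u`) to `z`. Its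
    -- last letter `y` lies in `z :: c`, so `z ≤ y`.
    · have hPz' : ∀ x ∈ P, x < z := fun x hx => (List.pairwise_append.mp hPz).2.2 x hx z (by simp)
      have hdu : d ∈ u := by
        obtain ⟨u', d', rfl⟩ := (List.eq_nil_or_concat u).resolve_left hu
        have h5 := congrArg List.getLast? hL
        simp [← List.append_assoc] at h5
        simp [h5]
      have hzd := hzu d hdu
      obtain ⟨Q, G, y, hQ, hQl, hQy, hyG, hG⟩ := hM
      have hcv : ∀ x ∈ c, z < x := fun x hx => hzv x (hc.subset hx)
      have hQy' : ∀ x ∈ Q, x < y := fun x hx => (List.pairwise_append.mp hQy).2.2 x hx y (by simp)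
      have hzy : z ≤ y := by
        have h4 : y ∈ z :: c := by
          have h5 := congrArg List.getLast? (hMeq.symm.trans hQ)
          rw [List.getLast?_append_cons, ← List.append_assoc, List.getLast?_concat] at h5
          exact List.mem_of_getLast? h5
        rcases List.mem_cons.mp h4 with h | h
        · exact h.ge
        · exact (hcv y h).le
      rw [hMeq] at hQ
      rcases List.append_eq_append_iff.mp hQ with ⟨w, h4, h5⟩ | ⟨w, h4, h5⟩
      · -- `Q` reaches at least up to `d`
        have hw : w = [] := by
          cases w with
          | nil => rfl
          | cons z' w =>
            simp only [List.cons_append, List.cons.injEq] at h5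
            obtain ⟨rfl, -⟩ := h5
            have h6 := (List.pairwise_append.mp hQy).1
            rw [h4] at h6
            exact absurd ((List.pairwise_append.mp h6).2.2 d (by simp) z (by simp)) hzd.not_gt
        subst hw
        have hGne : G ≠ [] := by
          rintro rfl
          have := hG.length
          simp at this; omega
        obtain ⟨g, G', rfl⟩ := List.exists_cons_of_ne_nil hGne
        simp only [List.nil_append, List.cons_append, List.cons.injEq] at h5
        exact absurd (hyG g (by simp)) (by rw [← h5.1]; exact hzy.not_gt)
      -- The letters of `G` exceed `y ≥ z`, so `z` is not in `G` and must be the last letter of the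
      -- match.
      · have hzG : z ∉ G := fun h => (hyG z h).not_ge hzy
        have hzy : y = z ∧ c = [] ∧ G = w := by
          rcases List.append_eq_append_iff.mp h5 with ⟨b, h6, h7⟩ | ⟨b, h6, h7⟩
          · cases b with
            | nil => simp at h7 h6; exact ⟨h7.1, h7.2, h6.symm⟩
            | cons b0 b => simp at h7
          · cases b with
            | nil => simp at h7 h6; exact ⟨h7.1.symm, h7.2, h6⟩
            | cons b0 b =>
              simp only [List.cons_append, List.cons.injEq] at h7
              exact absurd (by rw [h6, h7.1]; simp) hzG
        obtain ⟨rfl, rfl, rfl⟩ := hzy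
        rw [h4] at hL
        -- `Q` cannot reach into `u`, whose letters exceed `z`, and `G` cannot reach back into `P`,
        -- whose letters are below `z`.
        have hLQ : s ++ Q = P ∧ u = G := by
          rw [← List.append_assoc] at hL
          rcases List.append_eq_append_iff.mp hL with ⟨b, h6, h7⟩ | ⟨b, h6, h7⟩
          · rcases List.eq_nil_or_concat b with rfl | ⟨b', x, rfl⟩
            · simpa using And.intro h6 h7
            · obtain ⟨Q', x', rfl⟩ := (List.eq_nil_or_concat Q).resolve_left (by
                rintro rfl
                simp at hQl
                omega)
              have h8 := congrArg List.getLast? h6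
              simp only [← List.append_assoc, List.concat_eq_append, List.getLast?_concat,
                Option.some.injEq] at h8
              subst h8
              exact absurd (hQy' x' (by simp)) (hzu x' (by rw [h7]; simp)).not_gt
          · cases b with
            | nil => simpa using And.intro h6.symm h7.symm
            | cons x b =>
              exact absurd (hyG x (by rw [h7]; simp)) (hPz' x (by rw [h6]; simp)).not_gt
        obtain ⟨h6, rfl⟩ := hLQ
        refine h3 ⟨?_, hG⟩
        have h7 := congrArg List.length h6
        rw [List.length_append, hQl] at h7
        omega

/-- The leading letter of an increasing prefix of length `j` takes part in no match. -/
theorem avoids_cons_iff (hj : 3 ≤ j) (hp : 1 ≤ p) {a : α} {P l : List α}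
    (hP : P.length = j - 1) (hPl : ∀ x ∈ P, ∀ y ∈ l, x < y) :
    Avoids j γ (a :: P ++ l) ↔ Avoids j γ (P ++ l) := by
  refine ⟨fun h => h.of_infix ⟨[a], [], by simp⟩, ?_⟩
  rintro h M ⟨s, t, hst⟩ hM
  cases s with
  | cons b s =>
    simp only [List.cons_append, List.cons.injEq] at hst
    exact h M ⟨s, t, hst.2⟩ hM
  | nil =>
    -- A match starting at `a` would use up all of `a :: P` but its last letter, which would then
    -- open `G`; but that letter is smaller than `y`, which lies in `l`.
    obtain ⟨Q, G, y, rfl, hQl, hQy, hyG, hG⟩ := hM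
    have hGl := hG.length
    obtain ⟨g, G, rfl⟩ := List.exists_cons_of_ne_nil (l := G) (by rintro rfl; simp at hGl; omega)
    obtain ⟨P', x, rfl⟩ := (List.eq_nil_or_concat P).resolve_left (by
      rintro rfl
      simp at hP
      omega)
    rw [List.concat_eq_append] at *
    have h1 : Q ++ (g :: (G ++ [y] ++ t)) = (a :: P') ++ (x :: l) := by
      simpa using hst
    obtain ⟨-, h2⟩ := List.append_inj h1 (by simp at hP ⊢; omega)
    simp only [List.cons.injEq] at h2
    obtain ⟨rfl, h2⟩ := h2
    exact absurd (hyG g (by simp)) (hPl g (by simp) y (by rw [← h2]; simp)).not_gt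

end Matches

/-! ### Weighted sums over words with an increasing prefix -/

section Weight

variable {α : Type*} [LinearOrder α] {R : Type*} [CommRing R] {j p : ℕ}
  {γ : Equiv.Perm (Fin p)} {y : R}

open Classical in
/-- The weight `y ^ (1 + des l)` of a word `l` without matches; words with matches have weight
zero. -/
noncomputable def wordWeight (j : ℕ) (γ : Equiv.Perm (Fin p)) (y : R) (l : List α) : R :=
  if Avoids j γ l then y ^ (1 + listDes l) else 0

/-- The total weight of the words `P l`, where `l` runs through the words on `S`. -/
noncomputable def wordSum (j : ℕ) (γ : Equiv.Perm (Fin p)) (y : R) (P : List α)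
    (S : Finset α) : R :=
  ∑ l ∈ words S, wordWeight j γ y (P ++ l)

theorem wordSum_empty {P : List α} (hP : P.Pairwise (· < ·)) (hPj : P.length ≤ j - 1) :
    wordSum j γ y P ∅ = y := by
  rw [wordSum, words_empty, Finset.sum_singleton, List.append_nil, wordWeight,
    if_pos (avoids_of_length_lt (by omega)), listDes_eq_zero hP, add_zero, pow_one]

-- The descent into `z` supplies the second `1` in the exponent, so weights multiply. In the
-- exceptional case `P ++ u` is too short to contain a match and has weight `y ^ (1 + des γ)`, which
-- the subtraction removes.
open Classical in
theorem wordWeight_append_cons (hj : 3 ≤ j) (hp : 1 ≤ p) {P u v : List α} {z : α}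
    (hPz : (P ++ [z]).Pairwise (· < ·)) (hPj : P.length ≤ j - 1)
    (hu : u ≠ []) (hzu : ∀ x ∈ u, z < x) (hzv : ∀ x ∈ v, z < x) :
    wordWeight j γ y (P ++ u ++ z :: v) =
      (wordWeight j γ y (P ++ u) - if P.length = j - 1 then
        (if IsGamma γ u then y ^ (1 + listDes (List.ofFn γ)) else 0) else 0) *
      wordWeight j γ y ([z] ++ v) := by
  have hP := (List.pairwise_append.mp hPz).1
  have hPz' : ∀ x ∈ P, x < z := fun x hx => (List.pairwise_append.mp hPz).2.2 x hx z (by simp)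
  have hdes : listDes (P ++ u ++ z :: v) = listDes (P ++ u) + 1 + listDes (z :: v) := by
    rw [listDes_append_cons]
    obtain ⟨u', d, rfl⟩ := (List.eq_nil_or_concat u).resolve_left hu
    rw [List.concat_eq_append, ← List.append_assoc, listDes_concat_concat,
      if_pos (hzu d (by simp))]
  rw [List.singleton_append]
  simp only [wordWeight, avoids_append_cons_iff hj hp hPz hPj hu hzu hzv]
  by_cases hg : P.length = j - 1 ∧ IsGamma γ u
  · rw [if_neg (by tauto), if_pos hg.1, if_pos hg.2, if_pos (avoids_of_length_lt (by
      rw [List.length_append, hg.1, hg.2.length]; omega)),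
      listDes_append fun a ha b hb => (hPz' a ha).trans (hzu b hb), listDes_eq_zero hP,
      hg.2.listDes_eq]
    simp
  · rw [← ite_and, if_neg hg, sub_zero]
    by_cases h1 : Avoids j γ (P ++ u)
    · by_cases h2 : Avoids j γ (z :: v)
      · rw [if_pos ⟨h1, h2, hg⟩, if_pos h1, if_pos h2, hdes, ← pow_add]
        congr 1
        omega
      · rw [if_neg (by tauto), if_neg h2, mul_zero]
    · rw [if_neg (by tauto), if_neg h1, zero_mul]

/-- The recursion that splits words at the smallest letter after the prefix. -/
theorem wordSum_insert (hj : 3 ≤ j) (hp : 1 ≤ p) {P : List α} {z : α} {S : Finset α}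
    (hPz : (P ++ [z]).Pairwise (· < ·)) (hPj : P.length ≤ j - 1) (hzS : ∀ x ∈ S, z < x) :
    wordSum j γ y P (insert z S) = wordSum j γ y (P ++ [z]) S +
      ∑ T ∈ S.powerset, (wordSum j γ y P T - (if T.card = 0 then y else 0) -
        if P.length = j - 1 ∧ T.card = p then y ^ (1 + listDes (List.ofFn γ)) else 0) *
          wordSum j γ y [z] (S \ T) := by
  classical
  have hP := (List.pairwise_append.mp hPz).1
  have hz : z ∉ S := fun h => lt_irrefl z (hzS z h)
  have key : ∀ T ∈ S.powerset, ∑ u ∈ words T, ∑ v ∈ words (S \ T),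
      wordWeight j γ y (P ++ (u ++ z :: v)) = (if T = ∅ then wordSum j γ y (P ++ [z]) S else 0) +
      (wordSum j γ y P T - (if T.card = 0 then y else 0) -
        if P.length = j - 1 ∧ T.card = p then y ^ (1 + listDes (List.ofFn γ)) else 0) *
          wordSum j γ y [z] (S \ T) := by
    intro T hT
    -- `T` is the set of letters before `z`. For empty `T` the prefix grows, and the subtracted `y`
    -- cancels the weight of `P` alone.
    by_cases hT0 : T = ∅
    · subst hT0
      have hp0 : ¬ (0 = p) := by omega
      rw [words_empty, Finset.sum_singleton, Finset.sdiff_empty, wordSum_empty hP hPj]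
      simp [hp0, wordSum]
    · have hc : T.card ≠ 0 := by rwa [Ne, Finset.card_eq_zero]
      rw [if_neg hT0, if_neg hc, zero_add, sub_zero]
      have h1 : (if P.length = j - 1 ∧ T.card = p then y ^ (1 + listDes (List.ofFn γ)) else 0) =
          ∑ u ∈ words T, if P.length = j - 1 then
            (if IsGamma γ u then y ^ (1 + listDes (List.ofFn γ)) else 0) else 0 := by
        rw [ite_and, ← sum_words_isGamma (γ := γ) T]
        split_ifs with h
        · rfl
        · simp
      rw [h1, wordSum, wordSum, ← Finset.sum_sub_distrib, Finset.sum_mul_sum]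
      refine Finset.sum_congr rfl fun u hu => Finset.sum_congr rfl fun v hv => ?_
      rw [Finset.mem_powerset] at hT
      rw [← List.append_assoc, wordWeight_append_cons hj hp hPz hPj]
      · rintro rfl
        exact hc (by rw [← length_of_mem_words hu]; rfl)
      · exact fun x hx => hzS x (hT ((mem_of_mem_words hu).mp hx))
      · exact fun x hx => hzS x (Finset.mem_sdiff.mp ((mem_of_mem_words hv).mp hx)).1
  rw [wordSum, sum_words_insert hz fun l => wordWeight j γ y (P ++ l), Finset.sum_congr rfl key,
    Finset.sum_add_distrib, Finset.sum_ite_eq' S.powerset ∅, if_pos (Finset.empty_mem_powerset S)]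

/-- The leading letter is in no match and starts no descent, so prefixes of length `j` reduce to
length `j - 1`. -/
theorem wordSum_cons (hj : 3 ≤ j) (hp : 1 ≤ p) {a : α} {P : List α} {S : Finset α}
    (haP : (a :: P).Pairwise (· < ·)) (hP : P.length = j - 1) (hPS : ∀ x ∈ P, ∀ y ∈ S, x < y) :
    wordSum j γ y (a :: P) S = wordSum j γ y P S := by
  refine Finset.sum_congr rfl fun l hl => ?_
  have hPl : ∀ x ∈ P, ∀ y ∈ l, x < y := fun x hx y hy => hPS x hx y ((mem_of_mem_words hl).mp hy)
  have hd : listDes (a :: P ++ l) = listDes (P ++ l) := by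
    cases P with
    | nil => simp at hP; omega
    | cons b P =>
      rw [List.cons_append, List.cons_append, listDes,
        if_neg (((List.pairwise_cons.mp haP).1 b (by simp)).not_gt), zero_add]
  rw [wordWeight, wordWeight, hd]
  by_cases h : Avoids j γ (P ++ l)
  · rw [if_pos h, if_pos ((avoids_cons_iff hj hp hP hPl).mpr h)]
  · rw [if_neg h, if_neg fun h' => h ((avoids_cons_iff hj hp hP hPl).mp h')]

/-- The value of `wordSum` for a prefix of length `k` and a set with `n` elements. -/
noncomputable def prefixSum (j p : ℕ) (y c : R) : ℕ → ℕ → R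
  | 0, _ => y
  | n + 1, k => prefixSum j p y c n (min (k + 1) (j - 1)) +
      ∑ i : Fin (n + 1), (n.choose i : R) *
        ((prefixSum j p y c i k - (if (i : ℕ) = 0 then y else 0) -
          if k = j - 1 ∧ (i : ℕ) = p then c else 0) * prefixSum j p y c (n - i) 1)
termination_by n => n
decreasing_by all_goals omega

theorem prefixSum_zero (c : R) (k : ℕ) : prefixSum j p y c 0 k = y := by
  rw [prefixSum]

theorem prefixSum_succ (c : R) (n k : ℕ) :
    prefixSum j p y c (n + 1) k = prefixSum j p y c n (min (k + 1) (j - 1)) +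
      ∑ i ∈ Finset.range (n + 1), (n.choose i : R) *
        ((prefixSum j p y c i k - (if i = 0 then y else 0) -
          if k = j - 1 ∧ i = p then c else 0) * prefixSum j p y c (n - i) 1) := by
  rw [prefixSum, ← Fin.sum_univ_eq_sum_range fun i => (n.choose i : R) *
        ((prefixSum j p y c i k - (if i = 0 then y else 0) -
          if k = j - 1 ∧ i = p then c else 0) * prefixSum j p y c (n - i) 1)]

theorem wordSum_eq_prefixSum (hj : 3 ≤ j) (hp : 1 ≤ p) (n : ℕ) :
    ∀ (P : List α) (S : Finset α), S.card = n → P.Pairwise (· < ·) → (∀ x ∈ P, ∀ y ∈ S, x < y) →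
      1 ≤ P.length → P.length ≤ j - 1 →
      wordSum j γ y P S = prefixSum j p y (y ^ (1 + listDes (List.ofFn γ))) n P.length := by
  induction n using Nat.strong_induction_on with
  | _ n ih =>
    intro P S hS hP hPS hP1 hPj
    cases n with
    | zero =>
      rw [Finset.card_eq_zero] at hS
      rw [hS, wordSum_empty hP hPj, prefixSum_zero]
    | succ n =>
      have hne : S.Nonempty := by rw [← Finset.card_pos]; omega
      obtain ⟨z, S', hz, rfl, hzS⟩ := exists_min_insert hne
      rw [Finset.card_insert_of_notMem hz, Nat.add_right_cancel_iff] at hS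
      have hPz : (P ++ [z]).Pairwise (· < ·) := by
        rw [List.pairwise_append]
        refine ⟨hP, by simp, fun a ha b hb => ?_⟩
        rw [List.mem_singleton] at hb
        exact hPS a ha b (by simp [hb])
      have hPS' : ∀ x ∈ P, ∀ y ∈ S', x < y := fun x hx y hy => hPS x hx y (by simp [hy])
      have hPzS : ∀ x ∈ P ++ [z], ∀ y ∈ S', x < y := by
        intro x hx y hy
        rcases List.mem_append.mp hx with hx | hx
        · exact hPS' x hx y hy
        · rw [List.mem_singleton] at hx
          exact hx ▸ hzS y hy
      rw [wordSum_insert hj hp hPz hPj hzS, prefixSum_succ]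
      congr 1
      · rcases lt_or_eq_of_le hPj with hlt | heq
        · rw [ih n (Nat.lt_succ_self n) _ S' hS hPz hPzS (by simp) (by simp; omega),
            List.length_append, List.length_singleton, min_eq_left (by omega)]
        -- The prefix has reached length `j`; dropping its first letter explains the cap `j - 1` in
        -- `prefixSum`.
        · rw [min_eq_right (by omega)]
          cases P with
          | nil => simp at hP1
          | cons a P =>
            have hl : (P ++ [z]).length = j - 1 := by simpa using heq
            rw [List.cons_append] at hPz hPzS ⊢
            have hPzS' := fun x hx => hPzS x (List.mem_cons_of_mem a hx)
            rw [wordSum_cons hj hp hPz hl hPzS', ih n (Nat.lt_succ_self n) _ S' hS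
              (List.pairwise_cons.mp hPz).2 hPzS' (by omega) hl.le, hl]
      · rw [← hS]
        simp only [← nsmul_eq_mul]
        rw [← Finset.sum_powerset_apply_card (fun i =>
          ((prefixSum j p y (y ^ (1 + listDes (List.ofFn γ))) i P.length -
            (if i = 0 then y else 0) -
            if P.length = j - 1 ∧ i = p then y ^ (1 + listDes (List.ofFn γ)) else 0) *
            prefixSum j p y (y ^ (1 + listDes (List.ofFn γ))) (S'.card - i) 1))]
        refine Finset.sum_congr rfl fun T hT => ?_
        rw [Finset.mem_powerset] at hT
        have h1 := Finset.card_le_card hT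
        rw [ih T.card (by omega) P T rfl hP (fun x hx y hy => hPS' x hx y (hT hy)) hP1 hPj,
          ih (S' \ T).card (by have := Finset.card_le_card (Finset.sdiff_subset (s := S') (t := T));
                               omega) [z] (S' \ T) rfl (by simp)
            (fun x hx y hy => by
              rw [List.mem_singleton] at hx
              exact hx ▸ hzS y (Finset.mem_sdiff.mp hy).1) (by simp) (by simp; omega),
          Finset.card_sdiff_of_subset hT, List.length_singleton]

end Weight

end CycleMatch
namespace CycleMatch

/-! ### Cycles as words -/

section CycleWords

variable {n : ℕ}

/-- The cycle of `σ` that contains `a`, written as a word that starts with `a`. -/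
noncomputable def cycleWord (σ : Equiv.Perm (Fin n)) (a : Fin n) : List (Fin n) :=
  (List.range (cycleLen σ a)).map (cycleEntry σ a)

theorem cycleLen_pos (σ : Equiv.Perm (Fin n)) (a : Fin n) : 0 < cycleLen σ a := by
  refine Function.minimalPeriod_pos_of_mem_periodicPts ?_
  refine ⟨orderOf σ, orderOf_pos σ, ?_⟩
  rw [Function.IsPeriodicPt, Function.IsFixedPt, Equiv.Perm.iterate_eq_pow, pow_orderOf_eq_one]
  rfl

theorem cycleEntry_eq_iterate (σ : Equiv.Perm (Fin n)) (a : Fin n) (k : ℕ) :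
    cycleEntry σ a k = σ^[k] a := by
  rw [cycleEntry, Equiv.Perm.iterate_eq_pow]

theorem cycleEntry_mod (σ : Equiv.Perm (Fin n)) (a : Fin n) (k : ℕ) :
    cycleEntry σ a (k % cycleLen σ a) = cycleEntry σ a k := by
  rw [cycleEntry_eq_iterate, cycleEntry_eq_iterate, cycleLen, Function.iterate_mod_minimalPeriod_eq]

theorem cycleEntry_injOn (σ : Equiv.Perm (Fin n)) (a : Fin n) {k l : ℕ} (hk : k < cycleLen σ a)
    (hl : l < cycleLen σ a) (h : cycleEntry σ a k = cycleEntry σ a l) : k = l := by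
  rw [cycleEntry_eq_iterate, cycleEntry_eq_iterate] at h
  exact Function.iterate_injOn_Iio_minimalPeriod hk hl h

theorem cycleEntry_succ (σ : Equiv.Perm (Fin n)) (a : Fin n) (k : ℕ) :
    cycleEntry σ a (k + 1) = σ (cycleEntry σ a k) := by
  rw [cycleEntry, cycleEntry, pow_succ']; rfl

theorem length_cycleWord (σ : Equiv.Perm (Fin n)) (a : Fin n) :
    (cycleWord σ a).length = cycleLen σ a := by
  simp [cycleWord]

theorem nodup_cycleWord (σ : Equiv.Perm (Fin n)) (a : Fin n) : (cycleWord σ a).Nodup := by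
  refine List.Nodup.map_on (fun k hk l hl h => ?_) List.nodup_range
  rw [List.mem_range] at hk hl
  exact cycleEntry_injOn σ a hk hl h

theorem mem_cycleWord {σ : Equiv.Perm (Fin n)} {a b : Fin n} :
    b ∈ cycleWord σ a ↔ σ.SameCycle a b := by
  rw [cycleWord, List.mem_map]
  constructor
  · rintro ⟨k, -, rfl⟩
    exact ⟨k, by simp [cycleEntry]⟩
  · intro h
    obtain ⟨k, -, rfl⟩ := h.exists_pow_eq'
    refine ⟨k % cycleLen σ a, List.mem_range.mpr (Nat.mod_lt _ (cycleLen_pos σ a)), ?_⟩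
    rw [cycleEntry_mod]; rfl

theorem mem_cycleMins {σ : Equiv.Perm (Fin n)} {a : Fin n} :
    a ∈ cycleMins σ ↔ ∀ b ∈ cycleWord σ a, a ≤ b := by
  simp [cycleMins, mem_cycleWord]

theorem cycleWord_eq_cons (σ : Equiv.Perm (Fin n)) (a : Fin n) :
    ∃ l, cycleWord σ a = a :: l := by
  obtain ⟨k, hk⟩ : ∃ k, cycleLen σ a = k + 1 := ⟨cycleLen σ a - 1, by have := cycleLen_pos σ a; omega⟩
  rw [cycleWord, hk, List.range_succ_eq_map, List.map_cons]
  exact ⟨_, rfl⟩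

theorem formPerm_cycleWord_apply {σ : Equiv.Perm (Fin n)} {a b : Fin n}
    (h : b ∈ cycleWord σ a) : (cycleWord σ a).formPerm b = σ b := by
  obtain ⟨i, hi, rfl⟩ := List.getElem_of_mem h
  rw [List.formPerm_apply_getElem _ (nodup_cycleWord σ a)]
  simp only [cycleWord, List.getElem_map, List.getElem_range, List.length_map, List.length_range]
  rw [cycleEntry_mod, cycleEntry_succ]

/-- The length is a minimal period, hence determined by which iterates return to `a`. -/
theorem cycleWord_congr {σ τ : Equiv.Perm (Fin n)} {a : Fin n}
    (h : ∀ k, cycleEntry σ a k = cycleEntry τ a k) : cycleWord σ a = cycleWord τ a := by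
  have h1 : cycleLen σ a = cycleLen τ a := by
    rw [cycleLen, cycleLen, Function.minimalPeriod_eq_minimalPeriod_iff]
    intro k
    rw [Function.IsPeriodicPt, Function.IsPeriodicPt, Function.IsFixedPt, Function.IsFixedPt,
      ← cycleEntry_eq_iterate, ← cycleEntry_eq_iterate, h k]
  rw [cycleWord, cycleWord, h1]
  exact List.map_congr_left fun k _ => h k

theorem cycleWord_formPerm {z : Fin n} {l : List (Fin n)} (h : (z :: l).Nodup) :
    cycleWord (z :: l).formPerm z = z :: l := by
  have he : ∀ k, cycleEntry (z :: l).formPerm z k =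
      (z :: l)[k % (z :: l).length]'(Nat.mod_lt _ (by simp)) := fun k =>
    List.formPerm_pow_apply_head z l h k
  have hlen : cycleLen (z :: l).formPerm z = (z :: l).length := by
    apply Nat.dvd_antisymm
    · rw [cycleLen, ← Function.isPeriodicPt_iff_minimalPeriod_dvd, Function.IsPeriodicPt,
        Function.IsFixedPt, ← cycleEntry_eq_iterate, he]
      simp only [Nat.mod_self]
      rfl
    · have h1 := Function.isPeriodicPt_minimalPeriod (z :: l).formPerm z
      rw [Function.IsPeriodicPt, Function.IsFixedPt, ← cycleEntry_eq_iterate, he] at h1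
      have h2 : (z :: l)[cycleLen (z :: l).formPerm z % (z :: l).length]'(Nat.mod_lt _ (by simp)) =
        (z :: l)[0]'(by simp) := h1
      exact Nat.dvd_of_mod_eq_zero ((h.getElem_inj_iff).mp h2)
  apply List.ext_getElem
  · rw [length_cycleWord, hlen]
  · intro i h1 h2
    simp only [cycleWord, List.getElem_map, List.getElem_range]
    rw [he]
    simp only [Nat.mod_eq_of_lt h2]

end CycleWords

/-! ### The exponential formula: splitting off the cycle of the least letter -/

section PermSum

variable {n : ℕ} {R : Type*} [CommRing R]

open Classical in
/-- The permutations that fix every point outside `S`. -/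
noncomputable def permsOn (S : Finset (Fin n)) : Finset (Equiv.Perm (Fin n)) :=
  Finset.univ.filter fun σ => ∀ a, a ∉ S → σ a = a

theorem mem_permsOn {S : Finset (Fin n)} {σ : Equiv.Perm (Fin n)} :
    σ ∈ permsOn S ↔ ∀ a, a ∉ S → σ a = a := by
  simp [permsOn]

theorem apply_mem_of_mem_permsOn {S : Finset (Fin n)} {σ : Equiv.Perm (Fin n)}
    (h : σ ∈ permsOn S) {a : Fin n} (ha : a ∈ S) : σ a ∈ S := by
  by_contra hc
  have h1 := σ.injective (mem_permsOn.mp h _ hc)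
  exact hc (h1.symm ▸ ha)

/-- The sum over the permutations of `S` of the product of the weights of their cycles. -/
noncomputable def permSum (w : List (Fin n) → R) (S : Finset (Fin n)) : R :=
  -- Points outside `S` are fixed and so belong to `cycleMins σ`; the intersection discards them.
  ∑ σ ∈ permsOn S, ∏ a ∈ cycleMins σ ∩ S, w (cycleWord σ a)

section Glue

variable {z : Fin n} {l : List (Fin n)} {S T : Finset (Fin n)} {σ : Equiv.Perm (Fin n)}

theorem nodup_cons_of_mem_words (hz : ∀ x ∈ S, z < x) (hT : T ⊆ S) (hl : l ∈ words T) :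
    (z :: l).Nodup :=
  List.nodup_cons.mpr ⟨fun h => lt_irrefl z (hz z (hT ((mem_of_mem_words hl).mp h))),
    (mem_words.mp hl).1⟩

theorem cycleEntry_glue_of_mem (hz : ∀ x ∈ S, z < x) (hl : l ∈ words T)
    (hσ : σ ∈ permsOn (S \ T)) {a : Fin n} (ha : a ∈ S \ T) (k : ℕ) :
    cycleEntry ((z :: l).formPerm * σ) a k = cycleEntry σ a k ∧ cycleEntry σ a k ∈ S \ T := by
  induction k with
  | zero => exact ⟨rfl, ha⟩
  | succ k ih =>
    have h1 := apply_mem_of_mem_permsOn hσ ih.2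
    rw [cycleEntry_succ, cycleEntry_succ, ih.1, Equiv.Perm.mul_apply]
    refine ⟨List.formPerm_apply_of_notMem fun h => ?_, h1⟩
    have h2 := Finset.mem_sdiff.mp h1
    rcases List.mem_cons.mp h with h | h
    · exact lt_irrefl z (hz z (h ▸ h2.1))
    · exact h2.2 ((mem_of_mem_words hl).mp h)

theorem cycleWord_glue_of_mem (hz : ∀ x ∈ S, z < x) (hl : l ∈ words T)
    (hσ : σ ∈ permsOn (S \ T)) {a : Fin n} (ha : a ∈ S \ T) :
    cycleWord ((z :: l).formPerm * σ) a = cycleWord σ a :=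
  cycleWord_congr fun k => (cycleEntry_glue_of_mem hz hl hσ ha k).1

theorem cycleWord_glue (hz : ∀ x ∈ S, z < x) (hT : T ⊆ S) (hl : l ∈ words T)
    (hσ : σ ∈ permsOn (S \ T)) : cycleWord ((z :: l).formPerm * σ) z = z :: l := by
  have hmem : ∀ k, cycleEntry (z :: l).formPerm z k ∈ z :: l := by
    intro k
    induction k with
    | zero => simp [cycleEntry]
    | succ k ih => rw [cycleEntry_succ]; exact List.formPerm_apply_mem_of_mem ih
  conv_rhs => rw [← cycleWord_formPerm (nodup_cons_of_mem_words hz hT hl)]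
  refine cycleWord_congr fun k => ?_
  induction k with
  | zero => rfl
  | succ k ih =>
    rw [cycleEntry_succ, cycleEntry_succ, ih, Equiv.Perm.mul_apply, mem_permsOn.mp hσ]
    intro h
    have h2 := Finset.mem_sdiff.mp h
    rcases List.mem_cons.mp (hmem k) with h3 | h3
    · rw [h3] at h2
      exact lt_irrefl z (hz z h2.1)
    · exact h2.2 ((mem_of_mem_words hl).mp h3)

theorem glue_mem_permsOn (hT : T ⊆ S) (hl : l ∈ words T) (hσ : σ ∈ permsOn (S \ T)) :
    (z :: l).formPerm * σ ∈ permsOn (insert z S) := by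
  rw [mem_permsOn]
  intro a ha
  rw [Finset.mem_insert, not_or] at ha
  rw [Equiv.Perm.mul_apply, mem_permsOn.mp hσ a fun h => ha.2 (Finset.mem_sdiff.mp h).1]
  refine List.formPerm_apply_of_notMem fun h => ?_
  rcases List.mem_cons.mp h with h | h
  · exact ha.1 h
  · exact ha.2 (hT ((mem_of_mem_words hl).mp h))

/-- Letters of `T` share a cycle with the smaller `z`, and the cycles inside `S \ T` are unchanged.
-/
theorem cycleMins_glue (hz : ∀ x ∈ S, z < x) (hT : T ⊆ S) (hl : l ∈ words T)
    (hσ : σ ∈ permsOn (S \ T)) :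
    cycleMins ((z :: l).formPerm * σ) ∩ insert z S = insert z (cycleMins σ ∩ (S \ T)) := by
  have hw := cycleWord_glue hz hT hl hσ
  ext a
  rw [Finset.mem_inter, Finset.mem_insert, Finset.mem_insert, Finset.mem_inter]
  by_cases haz : a = z
  · subst haz
    simp only [true_or, and_true, iff_true]
    rw [mem_cycleMins, hw]
    intro b hb
    rcases List.mem_cons.mp hb with rfl | hb
    · exact le_rfl
    · exact (hz b (hT ((mem_of_mem_words hl).mp hb))).le
  · by_cases haT : a ∈ T
    · have h1 : a ∉ cycleMins ((z :: l).formPerm * σ) := by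
        intro h
        have h2 : a ∈ cycleWord ((z :: l).formPerm * σ) z := by
          rw [hw]; exact List.mem_cons_of_mem z ((mem_of_mem_words hl).mpr haT)
        have h3 := mem_cycleMins.mp h z (mem_cycleWord.mpr (mem_cycleWord.mp h2).symm)
        exact (hz a (hT haT)).not_ge h3
      simp [h1, haz, haT]
    · by_cases haS : a ∈ S
      · have h1 := cycleWord_glue_of_mem hz hl hσ (Finset.mem_sdiff.mpr ⟨haS, haT⟩)
        rw [mem_cycleMins, mem_cycleMins, h1]
        simp [haz, haT, haS]
      · simp [haz, haS]

end Glue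

/-- Splitting off the cycle of the smallest element. -/
theorem permSum_insert (w : List (Fin n) → R) {z : Fin n} {S : Finset (Fin n)}
    (hz : ∀ x ∈ S, z < x) :
    permSum w (insert z S) =
      ∑ T ∈ S.powerset, (∑ l ∈ words T, w (z :: l)) * permSum w (S \ T) := by
  have h : ∀ T ∈ S.powerset, (∑ l ∈ words T, w (z :: l)) * permSum w (S \ T) =
      ∑ q ∈ words T ×ˢ permsOn (S \ T),
        w (z :: q.1) * ∏ a ∈ cycleMins q.2 ∩ (S \ T), w (cycleWord q.2 a) := fun T _ => by
    rw [permSum, Finset.sum_mul_sum, Finset.sum_product]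
  rw [Finset.sum_congr rfl h, Finset.sum_sigma']
  symm
  refine Finset.sum_bij (fun q _ => (z :: q.2.1).formPerm * q.2.2) ?_ ?_ ?_ ?_
  · rintro ⟨T, l, σ⟩ hq
    simp only [Finset.mem_sigma, Finset.mem_powerset, Finset.mem_product] at hq
    exact glue_mem_permsOn hq.1 hq.2.1 hq.2.2
  · rintro ⟨T, l, σ⟩ hq ⟨T', l', σ'⟩ hq' heq
    simp only [Finset.mem_sigma, Finset.mem_powerset, Finset.mem_product] at hq hq' heq
    have h1 := cycleWord_glue hz hq.1 hq.2.1 hq.2.2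
    rw [heq, cycleWord_glue hz hq'.1 hq'.2.1 hq'.2.2, List.cons.injEq] at h1
    obtain ⟨-, rfl⟩ := h1
    have h2 : T = T' := by
      rw [← (mem_words.mp hq.2.1).2, ← (mem_words.mp hq'.2.1).2]
    have h3 := mul_left_cancel heq
    subst h2 h3
    rfl
  · intro σ hσ
    obtain ⟨l, hl⟩ := cycleWord_eq_cons σ z
    have hn := nodup_cycleWord σ z
    have hf := fun b => @formPerm_cycleWord_apply n σ z b
    rw [hl] at hn hf
    have hlS : l.toFinset ⊆ S := by
      intro b hb
      rw [List.mem_toFinset] at hb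
      have hbz : b ≠ z := by
        rintro rfl
        exact (List.nodup_cons.mp hn).1 hb
      by_contra hc
      have h1 := mem_permsOn.mp hσ b (by simp [hbz, hc])
      have h2 : σ.SameCycle z b := mem_cycleWord.mp (by rw [hl]; exact List.mem_cons_of_mem z hb)
      exact hbz (h2.symm.eq_of_left h1)
    -- Multiplying by the inverse of the cycle through `z` turns its letters into fixed points.
    refine ⟨⟨l.toFinset, l, (z :: l).formPerm⁻¹ * σ⟩, ?_, by simp⟩
    simp only [Finset.mem_sigma, Finset.mem_powerset, Finset.mem_product]
    refine ⟨hlS, mem_words.mpr ⟨(List.nodup_cons.mp hn).2, rfl⟩, ?_⟩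
    rw [mem_permsOn]
    intro a ha
    rw [Equiv.Perm.mul_apply, Equiv.Perm.inv_eq_iff_eq]
    by_cases hal : a ∈ z :: l
    · exact (hf a hal).symm
    · rw [List.formPerm_apply_of_notMem hal]
      rw [List.mem_cons, not_or] at hal
      refine mem_permsOn.mp hσ a ?_
      rw [Finset.mem_insert, not_or]
      exact ⟨hal.1, fun h => ha (Finset.mem_sdiff.mpr ⟨h, by simpa using hal.2⟩)⟩
  · rintro ⟨T, l, σ⟩ hq
    simp only [Finset.mem_sigma, Finset.mem_powerset, Finset.mem_product] at hq
    obtain ⟨hT, hl, hσ⟩ := hq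
    simp only
    rw [cycleMins_glue hz hT hl hσ, Finset.prod_insert, cycleWord_glue hz hT hl hσ]
    · congr 1
      refine Finset.prod_congr rfl fun a ha => ?_
      rw [cycleWord_glue_of_mem hz hl hσ (Finset.mem_inter.mp ha).2]
    · intro h
      exact lt_irrefl z (hz z (Finset.mem_sdiff.mp (Finset.mem_inter.mp h).2).1)

theorem permSum_empty (w : List (Fin n) → R) : permSum w ∅ = 1 := by
  have h : permsOn (∅ : Finset (Fin n)) = {1} := by
    ext σ
    rw [mem_permsOn, Finset.mem_singleton]
    exact ⟨fun h => Equiv.ext fun a => h a (by simp), by rintro rfl; simp⟩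
  simp [permSum, h]

/-- The exponential formula for cycle weights whose total depends only on the number of
letters. -/
theorem permSum_eq_linSol {w : List (Fin n) → R} {c : ℕ → R}
    (hw : ∀ (z : Fin n) (S : Finset (Fin n)), (∀ x ∈ S, z < x) →
      ∑ l ∈ words S, w (z :: l) = c S.card) (S : Finset (Fin n)) :
    permSum w S = linSol c S.card := by
  induction hm : S.card using Nat.strong_induction_on generalizing S with
  | _ m ih =>
    cases m with
    | zero =>
      rw [Finset.card_eq_zero] at hm
      rw [hm, permSum_empty, linSol_zero]
    | succ m =>
      have hne : S.Nonempty := by rw [← Finset.card_pos]; omega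
      obtain ⟨z, S', hz, rfl, hzS⟩ := exists_min_insert hne
      rw [Finset.card_insert_of_notMem hz, Nat.add_right_cancel_iff] at hm
      rw [permSum_insert w hzS, linSol_succ, ← hm]
      simp only [← nsmul_eq_mul]
      rw [← Finset.sum_powerset_apply_card (fun i => c i * linSol c (S'.card - i))]
      refine Finset.sum_congr rfl fun T hT => ?_
      rw [Finset.mem_powerset] at hT
      have h1 := Finset.card_le_card (Finset.sdiff_subset (s := S') (t := T))
      rw [hw z T fun x hx => hzS x (hT hx), ih (S' \ T).card (by omega) (S' \ T) rfl,
        Finset.card_sdiff_of_subset hT]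

end PermSum

end CycleMatch
namespace CycleMatch

/-! ### Reduction as order isomorphism -/

section Red

variable {n m : ℕ}

theorem red_lt_red_iff (w : Fin m → Fin n) (s t : Fin m) : red w s < red w t ↔ w s < w t := by
  have h1 : ∀ s t, w s ≤ w t → red w s ≤ red w t := fun s t h =>
    Finset.card_le_card fun x hx => by
      simp only [Finset.mem_filter, Finset.mem_univ, true_and] at hx ⊢
      exact hx.trans_le h
  constructor
  · intro h
    by_contra hc
    exact (h1 t s (not_lt.mp hc)).not_gt h
  · intro h
    refine Finset.card_lt_card (Finset.ssubset_iff_of_subset (fun x hx => ?_) |>.mpr ⟨s, ?_, ?_⟩)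
    · simp only [Finset.mem_filter, Finset.mem_univ, true_and] at hx ⊢
      exact hx.trans h
    · simpa using h
    · simp

theorem red_eq_iff (w : Fin m → Fin n) (τ : Equiv.Perm (Fin m)) :
    (∀ s, red w s = (τ s : ℕ)) ↔ ∀ s t, w s < w t ↔ τ s < τ t := by
  constructor
  · intro h s t
    rw [← red_lt_red_iff, h, h, Fin.lt_def]
  · intro h s
    have h1 : (Finset.univ.filter fun t => w t < w s) = (Finset.Iio (τ s)).map τ.symm.toEmbedding := by
      ext t
      simp [h]
    rw [red, h1, Finset.card_map, Fin.card_Iio]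

end Red

/-! ### From the permutation `τ` to matching factors -/

section Shape

variable {j p : ℕ} {γ : Equiv.Perm (Fin p)} {τ : Equiv.Perm (Fin (j + p))}

theorem isMatch_ofFn_iff {n : ℕ} (hj : 3 ≤ j)
    (hinit : ∀ i : Fin (j + p), (i : ℕ) < j - 1 → τ i = i)
    (hmid : ∀ (i : Fin (j + p)) (k : Fin p), (i : ℕ) = j - 1 + k → (τ i : ℕ) = j + γ k)
    (hlast : ∀ i : Fin (j + p), (i : ℕ) = j + p - 1 → (τ i : ℕ) = j - 1)
    (w : Fin (j + p) → Fin n) :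
    IsMatch j γ (List.ofFn w) ↔ ∀ s, red w s = (τ s : ℕ) := by
  rw [red_eq_iff]
  constructor
  · rintro ⟨P, G, z, hw, hP, hPz, hzG, e, rfl⟩
    -- This word is the increasing rearrangement of `w`; its entry at index `τ s` will be `w s`.
    have hlen : (P ++ [z] ++ List.ofFn e).length = j + p := by simp [hP]; omega
    have hsort : (P ++ [z] ++ List.ofFn e).Pairwise (· < ·) := by
      rw [List.pairwise_append]
      refine ⟨hPz, ?_, ?_⟩
      · rw [List.pairwise_ofFn]
        exact fun i k h => e.strictMono h
      · have hz : ∀ b ∈ List.ofFn e, z < b := by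
          intro b hb
          obtain ⟨k, rfl⟩ := List.mem_ofFn.mp hb
          exact hzG _ (List.mem_ofFn.mpr ⟨γ.symm k, by simp⟩)
        intro a ha b hb
        rcases List.mem_append.mp ha with ha | ha
        · exact ((List.pairwise_append.mp hPz).2.2 a ha z (by simp)).trans (hz b hb)
        · rw [List.mem_singleton] at ha
          exact ha ▸ hz b hb
    have hE : ∀ s t : Fin (j + p),
        (P ++ [z] ++ List.ofFn e)[(s : ℕ)]'(by omega) < (P ++ [z] ++ List.ofFn e)[(t : ℕ)]'(by omega)
          ↔ s < t := by
      intro s t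
      have h1 : ∀ s t : Fin (j + p), s < t → (P ++ [z] ++ List.ofFn e)[(s : ℕ)]'(by omega) <
          (P ++ [z] ++ List.ofFn e)[(t : ℕ)]'(by omega) := fun s t h =>
        List.pairwise_iff_getElem.mp hsort s t _ _ h
      refine ⟨fun h => ?_, h1 s t⟩
      by_contra hc
      rcases lt_or_eq_of_le (not_lt.mp hc) with h2 | rfl
      · exact lt_asymm h (h1 t s h2)
      · exact lt_irrefl _ h
    have hwE : ∀ s, w s = (P ++ [z] ++ List.ofFn e)[((τ s : Fin (j + p)) : ℕ)]'(by omega) := by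
      intro s
      have h1 : w s = (List.ofFn w)[(s : ℕ)]'(by simp) := by simp
      rw [h1]
      simp only [hw]
      have hs := s.isLt
      rcases lt_or_ge (s : ℕ) (j - 1) with h | h
      · have h2 := hinit s h
        simp only [h2]
        rw [List.getElem_append_left (by omega), List.getElem_append_left (by simp; omega),
          List.getElem_append_left (by omega)]
      · rcases lt_or_ge (s : ℕ) (j - 1 + p) with h' | h'
        · have h2 := hmid s ⟨s - (j - 1), by omega⟩ (by simp; omega)
          simp only [h2]
          rw [List.getElem_append_right (by omega), List.getElem_append_left (by simp; omega),
            List.getElem_append_right (by simp; omega)]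
          simp only [List.getElem_ofFn, List.length_append, List.length_singleton, hP]
          congr 1
          ext
          simp
          omega
        · have h2 := hlast s (by omega)
          simp only [h2]
          rw [List.getElem_append_right (by omega), List.getElem_append_right (by simp; omega),
            List.getElem_append_left (by simp; omega), List.getElem_append_right (by omega)]
          simp
    intro s t
    rw [hwE, hwE, hE]
  · intro h
    have hmono : ∀ s t : Fin (j + p), (τ s : ℕ) < τ t → w s < w t := fun s t hst =>
      (h s t).mpr hst
    have hmidl : ∀ k : Fin p, j - 1 + (k : ℕ) < j + p := fun k => by omega
    -- Sorting the middle block: its letter of rank `k` stands at position `γ.symm k`.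
    let e : Fin p ↪o Fin n := OrderEmbedding.ofStrictMono
      (fun k => w ⟨j - 1 + (γ.symm k : Fin p), hmidl _⟩) (fun k k' hk => by
        apply hmono
        rw [hmid _ (γ.symm k) rfl, hmid _ (γ.symm k') rfl]
        simpa using hk)
    refine ⟨List.ofFn fun i : Fin (j - 1) => w ⟨i, by omega⟩, List.ofFn fun k => e (γ k),
      w ⟨j + p - 1, by omega⟩, ?_, by simp, ?_, ?_, e, rfl⟩
    · apply List.ext_getElem
      · simp; omega
      · intro i h1 h2
        simp only [List.length_ofFn] at h1
        rcases lt_or_ge i (j - 1) with hi | hi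
        · rw [List.getElem_append_left (by simpa using hi)]
          simp
        · rw [List.getElem_append_right (by simpa using hi)]
          rcases lt_or_ge i (j - 1 + p) with hi' | hi'
          · rw [List.getElem_append_left (by simp; omega)]
            simp only [List.getElem_ofFn, List.length_ofFn, e]
            congr 1
            ext
            simp
            omega
          · rw [List.getElem_append_right (by simp; omega)]
            simp only [List.getElem_ofFn, List.getElem_singleton]
            congr 1
            ext
            simp
            omega
    · rw [List.pairwise_append]
      refine ⟨?_, by simp, ?_⟩
      · rw [List.pairwise_ofFn]
        intro i k hik
        apply hmono
        rw [hinit _ (by simp), hinit _ (by simp)]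
        simpa using hik
      · intro a ha b hb
        obtain ⟨i, rfl⟩ := List.mem_ofFn.mp ha
        rw [List.mem_singleton] at hb
        subst hb
        apply hmono
        rw [hinit _ (by simp), hlast _ rfl]
        exact i.isLt
    · intro g hg
      obtain ⟨k, rfl⟩ := List.mem_ofFn.mp hg
      apply hmono
      rw [hlast _ rfl, hmid _ (γ.symm (γ k)) rfl]
      omega

theorem permDes_eq (τ : Equiv.Perm (Fin (j + p))) : permDes τ = listDes (List.ofFn τ) := by
  rcases Nat.eq_zero_or_pos (j + p) with h0 | h0
  · rw [permDes]
    have : IsEmpty (Fin (j + p)) := by rw [h0]; infer_instance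
    have h1 : List.ofFn τ = [] := List.eq_nil_of_length_eq_zero (by simpa using h0)
    rw [h1, Finset.univ_eq_empty]
    rfl
  · have h1 : List.ofFn τ = (List.range (j + p)).map
        fun i => τ ⟨i % (j + p), Nat.mod_lt _ h0⟩ := by
      apply List.ext_getElem
      · simp
      · intro i h1 h2
        simp only [List.length_ofFn] at h1
        simp [Nat.mod_eq_of_lt h1]
    rw [h1, listDes_map_range, permDes]
    refine Finset.card_bij (fun i _ => (i : ℕ)) ?_ (fun i _ k _ h => Fin.ext h) ?_
    · intro i hi
      simp only [Finset.mem_filter, Finset.mem_univ, true_and, Finset.mem_range] at hi ⊢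
      obtain ⟨k, hk, hlt⟩ := hi
      refine ⟨by omega, ?_⟩
      simpa only [← hk, Nat.mod_eq_of_lt k.isLt, Nat.mod_eq_of_lt i.isLt] using hlt
    · intro i hi
      simp only [Finset.mem_filter, Finset.mem_range] at hi
      have h2 : i + 1 < j + p := by omega
      refine ⟨⟨i, by omega⟩, ?_, rfl⟩
      simp only [Finset.mem_filter, Finset.mem_univ, true_and]
      refine ⟨⟨i + 1, h2⟩, rfl, ?_⟩
      have h3 := hi.2
      simpa only [Nat.mod_eq_of_lt h2, Nat.mod_eq_of_lt (Nat.lt_of_succ_lt h2)] using h3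

/-- Besides the descents inside `γ` there is only the one from the end of `γ` to the last letter. -/
theorem permDes_eq_of_shape (hj : 3 ≤ j) (hp : 1 ≤ p)
    (hinit : ∀ i : Fin (j + p), (i : ℕ) < j - 1 → τ i = i)
    (hmid : ∀ (i : Fin (j + p)) (k : Fin p), (i : ℕ) = j - 1 + k → (τ i : ℕ) = j + γ k)
    (hlast : ∀ i : Fin (j + p), (i : ℕ) = j + p - 1 → (τ i : ℕ) = j - 1) :
    permDes τ = 1 + listDes (List.ofFn γ) := by
  have hm : IsMatch j γ (List.ofFn τ) :=
    (isMatch_ofFn_iff hj hinit hmid hlast τ).mpr ((red_eq_iff _ τ).mpr fun _ _ => Iff.rfl)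
  obtain ⟨P, G, z, h, hP, hPz, hzG, hG⟩ := hm
  rw [permDes_eq, h, ← hG.listDes_eq, listDes_append, listDes_eq_zero (List.pairwise_append.mp hPz).1]
  · obtain ⟨G', g, rfl⟩ := (List.eq_nil_or_concat G).resolve_left (by
      rintro rfl
      have := hG.length
      simp at this
      omega)
    rw [List.concat_eq_append, listDes_concat_concat, if_pos (hzG g (by simp))]
    omega
  · intro a ha b hb
    have h1 := (List.pairwise_append.mp hPz).2.2 a ha z (by simp)
    rcases List.mem_append.mp hb with hb | hb
    · exact h1.trans (hzG b hb)
    · rw [List.mem_singleton] at hb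
      exact hb ▸ h1

theorem hasCycleMatch_iff {n : ℕ} (hj : 3 ≤ j)
    (hinit : ∀ i : Fin (j + p), (i : ℕ) < j - 1 → τ i = i)
    (hmid : ∀ (i : Fin (j + p)) (k : Fin p), (i : ℕ) = j - 1 + k → (τ i : ℕ) = j + γ k)
    (hlast : ∀ i : Fin (j + p), (i : ℕ) = j + p - 1 → (τ i : ℕ) = j - 1)
    (σ : Equiv.Perm (Fin n)) :
    HasCycleMatch τ σ ↔ ∃ a ∈ cycleMins σ, ¬ Avoids j γ (cycleWord σ a) := by
  refine exists_congr fun a => and_congr_right fun ha => ?_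
  have hmatch := fun r => isMatch_ofFn_iff (γ := γ) hj hinit hmid hlast
    (fun t : Fin (j + p) => cycleEntry σ a (r + t))
  simp only [← hmatch, Avoids, not_forall, not_not]
  constructor
  · rintro ⟨hlen, r, hr, hm⟩
    have hr' : r + (j + p) ≤ cycleLen σ a := by
      -- A wrapping window would contain the cycle minimum `a` at position `cycleLen σ a - r > 0`,
      -- while `τ` puts its smallest letter at position `0`.
      by_contra hc
      have h1 := (red_eq_iff _ τ).mp ((hmatch r).mp hm) ⟨0, by omega⟩ ⟨cycleLen σ a - r, by omega⟩
      have h2 : τ ⟨0, by omega⟩ = ⟨0, by omega⟩ := hinit _ (by simp; omega)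
      have h3 : τ ⟨0, by omega⟩ < τ ⟨cycleLen σ a - r, by omega⟩ := by
        rw [h2, Fin.lt_def]
        rw [Nat.pos_iff_ne_zero]
        intro h4
        have h5 : τ ⟨cycleLen σ a - r, by omega⟩ = τ ⟨0, by omega⟩ := by
          rw [h2]; exact Fin.ext h4
        have h6 := congrArg Fin.val (τ.injective h5)
        simp only at h6
        omega
      have h7 := h1.mpr h3
      simp only [Nat.add_sub_cancel' hr.le] at h7
      have h8 : cycleEntry σ a (cycleLen σ a) = a := by
        rw [← cycleEntry_mod, Nat.mod_self]; rfl
      rw [h8] at h7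
      refine (mem_cycleMins.mp ha _ ?_).not_gt h7
      exact mem_cycleWord.mpr ⟨r, by simp [cycleEntry]⟩
    refine ⟨_, ?_, hm⟩
    have h1 : List.ofFn (fun t : Fin (j + p) => cycleEntry σ a (r + t)) =
        ((cycleWord σ a).drop r).take (j + p) := by
      apply List.ext_getElem
      · simp [length_cycleWord]; omega
      · intro i h1 h2
        simp [cycleWord]
    rw [h1]
    exact (List.take_prefix _ _).isInfix.trans (List.drop_suffix _ _).isInfix
  · rintro ⟨u, ⟨s, t, hst⟩, hu⟩
    have hul := hu.length
    have hlen := congrArg List.length hst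
    rw [length_cycleWord] at hlen
    simp only [List.length_append, hul] at hlen
    refine ⟨by omega, s.length, by omega, ?_⟩
    have h1 : List.ofFn (fun t : Fin (j + p) => cycleEntry σ a (s.length + t)) = u := by
      apply List.ext_getElem
      · simp; omega
      · intro i h1 h2
        have h3 : u[i] = (cycleWord σ a)[s.length + i]'(by
            rw [length_cycleWord]; omega) := by
          simp only [← hst]
          rw [List.getElem_append_left (by simp; omega), List.getElem_append_right (by omega)]
          simp
        rw [h3]
        simp [cycleWord]
    rw [h1]
    exact hu

-- Give each cycle the weight `x y^(1 + des)`, or `0` if it contains a match; the product over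
-- cycles is the summand of `σ`, and the exponential formula applies.
open Polynomial in
theorem ncmPoly_eq (hj : 3 ≤ j) (hp : 1 ≤ p)
    (hinit : ∀ i : Fin (j + p), (i : ℕ) < j - 1 → τ i = i)
    (hmid : ∀ (i : Fin (j + p)) (k : Fin p), (i : ℕ) = j - 1 + k → (τ i : ℕ) = j + γ k)
    (hlast : ∀ i : Fin (j + p), (i : ℕ) = j + p - 1 → (τ i : ℕ) = j - 1) (n : ℕ) :
    ncmPoly τ n = linSol (fun i => (X : ℚ[X][X]) *
      C (prefixSum j p (X : ℚ[X]) (X ^ permDes τ) i 1)) n := by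
  have h1 := permSum_eq_linSol (n := n)
    (w := fun l => (X : ℚ[X][X]) * C (wordWeight j γ (X : ℚ[X]) l))
    (c := fun i => (X : ℚ[X][X]) * C (prefixSum j p (X : ℚ[X]) (X ^ permDes τ) i 1))
    (fun z S hz => by
      rw [← Finset.mul_sum, ← map_sum, permDes_eq_of_shape hj hp hinit hmid hlast]
      congr 2
      exact wordSum_eq_prefixSum hj hp S.card [z] S rfl (by simp)
        (fun x hx y hy => by rw [List.mem_singleton] at hx; exact hx ▸ hz y hy) (by simp)
        (by simp; omega)) Finset.univ
  rw [Finset.card_univ, Fintype.card_fin] at h1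
  rw [← h1, permSum, ncmPoly, ncms, Finset.sum_filter]
  have h2 : permsOn (Finset.univ : Finset (Fin n)) = Finset.univ := by
    ext σ; simp [mem_permsOn]
  rw [h2]
  refine Finset.sum_congr rfl fun σ _ => ?_
  rw [Finset.inter_univ]
  split_ifs with h
  · rw [hasCycleMatch_iff hj hinit hmid hlast] at h
    obtain ⟨a, ha, hm⟩ := h
    rw [Finset.prod_eq_zero ha]
    rw [wordWeight, if_neg hm, map_zero, mul_zero]
  · rw [hasCycleMatch_iff hj hinit hmid hlast] at h
    push Not at h
    rw [Finset.prod_mul_distrib, Finset.prod_const, cyc, ← map_prod]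
    congr 2
    rw [cdes, ← Finset.prod_pow_eq_pow_sum]
    refine Finset.prod_congr rfl fun a ha => ?_
    rw [wordWeight, if_pos (h a ha), cycleWord, listDes_map_range, des]

end Shape

/-! ### The differential system and the coefficient recursion -/

section PrefixSum

variable {R : Type*} [CommRing R] [Algebra ℚ R]

open PowerSeries

theorem derivative_egf_prefixSum (j p : ℕ) (y c : R) (k : ℕ) :
    derivative R (egf fun n => prefixSum j p y c n k) =
      egf (fun n => prefixSum j p y c n (min (k + 1) (j - 1))) +
      (egf (fun n => prefixSum j p y c n k) - C y -
        if k = j - 1 then C ((1 / (p.factorial : ℚ)) • c) * X ^ p else 0) *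
        egf (fun n => prefixSum j p y c n 1) := by
  have h1 : C y = egf (fun n => if n = 0 then y else 0) := by
    rw [egf_single]; simp
  have h2 : (if k = j - 1 then C ((1 / (p.factorial : ℚ)) • c) * X ^ p else 0) =
      egf (fun n => if k = j - 1 ∧ n = p then c else 0) := by
    split_ifs with h
    · simp only [h, true_and]
      rw [egf_single]
    · simp only [h, false_and, if_false]
      ext n
      simp [coeff_egf]
  rw [h1, h2, egf_sub, egf_sub, egf_mul, egf_add, derivative_egf]
  congr 1
  funext n
  exact prefixSum_succ c n k

/-- `t^p / p!` is the generating function of a sequence supported at `p`, so one term of the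
binomial convolution survives. For `n < p` the truncated index is harmless, since the binomial
coefficient vanishes. -/
theorem coeff_recursion_of_derivative {j p : ℕ} (hj : 1 ≤ j) (U : ℕ → R) (a c : R)
    (h : (derivative R)^[j] (egf U) = C a * (derivative R)^[j - 1] (egf U) -
      C ((1 / (p.factorial : ℚ)) • c) * X ^ p * derivative R (egf U)) (n : ℕ) :
    U (n + j) = a * U (n + j - 1) - c * (n.choose p : R) * U (n + 1 - p) := by
  rw [← egf_single, iterate_derivative_egf, iterate_derivative_egf, derivative_egf, C_mul_egf,
    egf_mul, egf_sub] at h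
  have h1 := congrFun (egf_injective h) n
  rw [h1, Nat.add_sub_assoc hj]
  congr 1
  rcases lt_or_ge n p with hnp | hnp
  · rw [Nat.choose_eq_zero_of_lt hnp, Finset.sum_eq_zero]
    · simp
    · intro i hi
      rw [Finset.mem_range] at hi
      rw [if_neg (by omega), zero_mul, mul_zero]
  · rw [Finset.sum_eq_single_of_mem p (Finset.mem_range.mpr (by omega))]
    · rw [if_pos rfl, show n - p + 1 = n + 1 - p by omega]
      ring
    · intro i _ hi
      rw [if_neg hi, zero_mul, mul_zero]

end PrefixSum

end CycleMatch

/-! ### The main theorem -/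

theorem mainTheorem3 (j p : ℕ) (hj : 3 ≤ j) (hp : 1 ≤ p)
    (γ : Equiv.Perm (Fin p)) (τ : Equiv.Perm (Fin (j + p)))
    (hinit : ∀ i : Fin (j + p), (i : ℕ) < j - 1 → τ i = i)
    (hmid : ∀ (i : Fin (j + p)) (k : Fin p), (i : ℕ) = j - 1 + k → (τ i : ℕ) = j + γ k)
    (hlast : ∀ i : Fin (j + p), (i : ℕ) = j + p - 1 → (τ i : ℕ) = j - 1) :
    ∃ U : ℕ → Polynomial ℚ,
      U 0 = 1 ∧
      CycleMatch.NCM τ =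
        CycleMatch.pow (PowerSeries.map Polynomial.C (CycleMatch.egf U)) (-Polynomial.X) ∧
      (∀ n : ℕ, U (n + j) =
        (1 - Polynomial.X) * U (n + j - 1)
          - Polynomial.X ^ CycleMatch.permDes τ * (n.choose p : Polynomial ℚ) * U (n + 1 - p)) ∧
      (PowerSeries.derivative (Polynomial ℚ))^[j] (CycleMatch.egf U) =
        PowerSeries.C (1 - Polynomial.X) *
            (PowerSeries.derivative (Polynomial ℚ))^[j - 1] (CycleMatch.egf U)
          - PowerSeries.C ((1 / (p.factorial : ℚ)) • (Polynomial.X ^ CycleMatch.permDes τ)) *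
            PowerSeries.X ^ p * PowerSeries.derivative (Polynomial ℚ) (CycleMatch.egf U) := by
  have hE : (PowerSeries.derivative (Polynomial ℚ))^[j] (CycleMatch.egf (CycleMatch.linSol
        fun n => -CycleMatch.prefixSum j p Polynomial.X (Polynomial.X ^ CycleMatch.permDes τ) n 1)) =
      _ :=
    CycleMatch.iterate_derivative_of_system hj _
      (PowerSeries.C ((1 / (p.factorial : ℚ)) •
        (Polynomial.X ^ CycleMatch.permDes τ : Polynomial ℚ)) * PowerSeries.X ^ p) Polynomial.X
      (fun k => CycleMatch.egf fun n =>
        CycleMatch.prefixSum j p Polynomial.X (Polynomial.X ^ CycleMatch.permDes τ) n k)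
      (by
        rw [CycleMatch.derivative_egf_linSol, ← neg_mul]
        congr 1
        ext1 n
        simp [CycleMatch.coeff_egf])
      (fun k hk hkj => by
        rw [CycleMatch.derivative_egf_prefixSum, if_neg hkj.ne, sub_zero, min_eq_left (by omega)])
      (by rw [CycleMatch.derivative_egf_prefixSum, if_pos rfl, min_eq_right (by omega)])
  refine ⟨_, CycleMatch.linSol_zero _, ?_,
    CycleMatch.coeff_recursion_of_derivative (by omega) _ _ _ hE, hE⟩
  rw [CycleMatch.pow_map_egf_linSol_neg, CycleMatch.NCM]
  congr 1
  funext n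
  exact CycleMatch.ncmPoly_eq hj hp hinit hmid hlast n
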